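/- **Setting.** Let $\mathcal H=(\mathbb C^2)^{\otimes n}$, let $\mathcal G_n$ be the $n$-qubit Pauli group (with phases $\pm1,\pm i$), and let $\mathcal C\subseteq\mathcal H$ be an $[n,k]$ stabiliser code: the space fixed by an abelian subgroup $S\le\mathcal G_n$ with $-I\notin S$ and $n-k$ independent generators ($|S|=2^{n-k}$, $0\le k\le n$). Let $P$ be the orthogonal projector onto $\mathcal C$ and $N(S)$ the normaliser of $S$ in $\mathcal G_n$; $N(S)/S$ acts on $\mathcal C$. Let $E\subseteq\mathcal G_n$ be a set of physical errors, and let $\overline M\subseteq\overline{\mathcal G}_k$ be a set of admissible errors in the $k$-qubit (logical) Pauli group which contains the identity but need not be a group. For a coset (syndrome) $\mathfrak n\in\mathcal G_n/N(S)$ put $E_{\mathfrak n}=E\cap\mathfrak n$ and let $P_{\mathfrak n}=ePe^\dagger$ for any $e\in\mathfrak n$. Channels are completely positive trace-preserving maps on the operators on $\mathcal H$. A *physical noise channel* is a channel with Kraus operators proportional to elements of $E$. For a group isomorphism $\mathcal A:\overline{\mathcal G}_k\to N(S)/S$, an *admissible logical noise channel* is a channel which maps states supported on $\mathcal C$ to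 such states and has Kraus operators proportional to elements of the cosets $\mathcal A(\overline m)$, $\overline m\in\overline M$. A channel $\mathcal R$ is *transmuting with respect to $\mathcal A$* if for every physical noise channel $\mathcal E$ there is an admissible logical noise channel $\mathcal M$ with $\mathcal R(\mathcal E(\rho))=\mathcal M(\rho)$ for all density operators $\rho$ supported on $\mathcal C$. $\mathcal C$ is a *quantum error transmuting (QET) code* for $(E,\overline M)$ if there are an isomorphism $\mathcal A$ and a channel $\mathcal R$ that is transmuting with respect to $\mathcal A$. **Theorem.** 1. $\mathcal C$ is a QET code for $(E,\overline M)$ if and only if there is an isomorphism $\mathcal A:\overline{\mathcal G}_k\to N(S)/S$ such that for each $\mathfrak n$ there is a map $\pi_{\mathfrak n}:E_{\mathfrak n}\to\mathcal A(\overline M)$ such that, for all $E_{\mathfrak n,i},E_{\mathfrak n,j}\in E_{\mathfrak n}$, writing $\overline m_{\pi_{\mathfrak n},i}=\pi_{\mathfrak n}(E_{\mathfrak n,i})$, $$E_{\mathfrak n,i}^\dagger E_{\mathfrak n,j}\big|_{\mathcal C}=\overline m_{\pi_{\mathfrak n},i}^\dagger\,\overline m_{\pi_{\mathfrak n},j}$$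 as linear maps on $\mathcal C$, up to a global phase in $\{\pm1,\pm i\}$. 2. The same equivalence holds with the displayed condition replaced by: for all representatives $m_{\pi_{\mathfrak n},i},m_{\pi_{\mathfrak n},j}\in N(S)$ of $\overline m_{\pi_{\mathfrak n},i},\overline m_{\pi_{\mathfrak n},j}$, $E_{\mathfrak n,i}^\dagger E_{\mathfrak n,j}P=m_{\pi_{\mathfrak n},i}^\dagger m_{\pi_{\mathfrak n},j}P$ up to a global phase in $\{\pm1,\pm i\}$. 3. Syndrome measurement followed by the following recovery is the most general recovery protocol. Fix any isomorphism $\mathcal A$, any reference error $E_{\mathfrak n,1}\in E_{\mathfrak n}$ for each $\mathfrak n$ with $E_{\mathfrak n}\neq\emptyset$, and any choice of representatives in $N(S)$ of the elements of $N(S)/S$. Given, for each $\mathfrak n$, a probability distribution $r_{\mathfrak n}$ on the maps $\pi$ satisfying the condition in 1, and, for each $\mathfrak n$ with $E_{\mathfrak n}=\emptyset$, a channel $\mathcal Q_{\mathfrak n}$, let $$\mathcal R_{r,\mathcal Q}(\sigma)=\sum_{\mathfrak n:\,E_{\mathfrak n}\ne\emptyset}\ \sum_{\pi}r_{\mathfrak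 n}(\pi)\,m_{\pi,1}E_{\mathfrak n,1}^\dagger P_{\mathfrak n}\,\sigma\,P_{\mathfrak n}E_{\mathfrak n,1}m_{\pi,1}^\dagger+\sum_{\mathfrak n:\,E_{\mathfrak n}=\emptyset}\mathcal Q_{\mathfrak n}(P_{\mathfrak n}\sigma P_{\mathfrak n}),$$ where $m_{\pi,1}$ is the chosen representative of $\pi(E_{\mathfrak n,1})$. (a) Every such $\mathcal R_{r,\mathcal Q}$ is a channel that is transmuting with respect to $\mathcal A$. (b) For every channel $\mathcal R$ that is transmuting with respect to $\mathcal A$ there are such $r$ and $\mathcal Q$ with $\mathcal R\big(\sum_{\mathfrak n}P_{\mathfrak n}\sigma P_{\mathfrak n}\big)=\mathcal R_{r,\mathcal Q}(\sigma)$ for all operators $\sigma$; in addition $\mathcal R(\mathcal E(\rho))=\mathcal R_{r,\mathcal Q}(\mathcal E(\rho))$ for every physical noise channel $\mathcal E$ and every density operator $\rho$ supported on $\mathcal C$. -/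

import Mathlib

namespace QET

open Matrix
open scoped ComplexOrder

/-! ## The Pauli group on `n` qubits -/

/-- Labels of the computational basis of `(ℂ²)^{⊗n}`. -/
abbrev Idx (n : ℕ) : Type := Fin n → Fin 2

/-- Operators on the Hilbert space `(ℂ²)^{⊗n}`. -/
abbrev Op (n : ℕ) : Type := Matrix (Idx n) (Idx n) ℂ

/-- Superoperators: linear maps on the operators on `(ℂ²)^{⊗n}`. -/
abbrev SuperOp (n : ℕ) : Type := Op n →ₗ[ℂ] Op n

/-- The single-qubit Pauli matrices `I, X, Y, Z`. -/
def pauli : Fin 4 → Matrix (Fin 2) (Fin 2) ℂ :=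
  ![!![1, 0; 0, 1], !![0, 1; 1, 0], !![0, -Complex.I; Complex.I, 0], !![1, 0; 0, -1]]

/-- The tensor product of single-qubit matrices `A 0 ⊗ ⋯ ⊗ A (n - 1)`. -/
def tensor {n : ℕ} (A : Fin n → Matrix (Fin 2) (Fin 2) ℂ) : Op n :=
  Matrix.of fun x y => ∏ i, A i (x i) (y i)

/-- The Pauli string with label `p i` on qubit `i`. -/
def pauliString {n : ℕ} (p : Fin n → Fin 4) : Op n := tensor fun i => pauli (p i)

theorem tensor_mul {n : ℕ} (A B : Fin n → Matrix (Fin 2) (Fin 2) ℂ) :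
    tensor A * tensor B = tensor fun i => A i * B i := by
  ext x y
  simp only [tensor, Matrix.mul_apply, Matrix.of_apply]
  rw [Fintype.prod_sum]
  exact Finset.sum_congr rfl fun z _ => Finset.prod_mul_distrib.symm

theorem tensor_smul {n : ℕ} (c : Fin n → ℂ) (A : Fin n → Matrix (Fin 2) (Fin 2) ℂ) :
    (tensor fun i => c i • A i) = (∏ i, c i) • tensor A := by
  ext x y
  simp [tensor, Finset.prod_mul_distrib]

theorem tensor_one {n : ℕ} : (tensor fun _ : Fin n => (1 : Matrix (Fin 2) (Fin 2) ℂ)) = 1 := by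
  ext x y
  simp only [tensor, Matrix.of_apply, Matrix.one_apply]
  rw [Finset.prod_ite_zero]
  simp [funext_iff]

theorem pauli_zero : pauli 0 = 1 := by
  ext i j; fin_cases i <;> fin_cases j <;> simp [pauli]

theorem pauli_mul (p q : Fin 4) :
    ∃ (r : Fin 4) (c : ℂ), c ^ 4 = 1 ∧ pauli p * pauli q = c • pauli r := by
  have hI : Complex.I ^ 4 = 1 := Complex.I_pow_four
  have hI' : (-Complex.I) ^ 4 = 1 := by
    rw [Even.neg_pow (by decide), hI]
  fin_cases p <;> fin_cases q
  · exact ⟨0, 1, by simp, by simp [pauli]⟩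
  · exact ⟨1, 1, by simp, by simp [pauli]⟩
  · exact ⟨2, 1, by simp, by simp [pauli]⟩
  · exact ⟨3, 1, by simp, by simp [pauli]⟩
  · exact ⟨1, 1, by simp, by simp [pauli]⟩
  · exact ⟨0, 1, by simp, by simp [pauli]⟩
  · exact ⟨3, Complex.I, hI, by simp [pauli]⟩
  · exact ⟨2, -Complex.I, hI', by simp [pauli]⟩
  · exact ⟨2, 1, by simp, by simp [pauli]⟩
  · exact ⟨3, -Complex.I, hI', by simp [pauli]⟩
  · exact ⟨0, 1, by simp, by simp [pauli]⟩
  · exact ⟨1, Complex.I, hI, by simp [pauli]⟩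
  · exact ⟨3, 1, by simp, by simp [pauli]⟩
  · exact ⟨2, Complex.I, hI, by simp [pauli]⟩
  · exact ⟨1, -Complex.I, hI', by simp [pauli]⟩
  · exact ⟨0, 1, by simp, by simp [pauli]⟩

theorem pauli_star (p : Fin 4) : (pauli p)ᴴ = pauli p := by
  fin_cases p <;> ext i j <;> fin_cases i <;> fin_cases j <;> simp [pauli]

theorem pauliString_star {n : ℕ} (p : Fin n → Fin 4) : (pauliString p)ᴴ = pauliString p := by
  ext x y
  simp only [pauliString, tensor, Matrix.conjTranspose_apply, Matrix.of_apply, star_prod]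
  refine Finset.prod_congr rfl fun i _ => ?_
  conv_rhs => rw [← pauli_star (p i)]
  rfl

/-- The `n`-qubit Pauli group: all `c • (σ₁ ⊗ ⋯ ⊗ σₙ)` with `c ∈ {1, -1, i, -i}`. -/
def PauliGroup (n : ℕ) : Subgroup (Matrix.unitaryGroup (Idx n) ℂ) where
  carrier := {U | ∃ (c : ℂ) (p : Fin n → Fin 4), c ^ 4 = 1 ∧ (U : Op n) = c • pauliString p}
  mul_mem' := by
    rintro U V ⟨c, p, hc, hU⟩ ⟨d, q, hd, hV⟩
    choose r e he hr using fun i => pauli_mul (p i) (q i)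
    refine ⟨c * d * ∏ i, e i, r, ?_, ?_⟩
    · rw [mul_pow, mul_pow, hc, hd, ← Finset.prod_pow]
      simp [he]
    · rw [Matrix.UnitaryGroup.mul_val, hU, hV]
      simp only [pauliString, Matrix.smul_mul, Matrix.mul_smul, tensor_mul, hr, tensor_smul,
        smul_smul]
      congr 1
      ring
  one_mem' := ⟨1, fun _ => 0, by simp, by
    simp [pauliString, pauli_zero, tensor_one]⟩
  inv_mem' := by
    rintro U ⟨c, p, hc, hU⟩
    refine ⟨star c, p, by rw [← star_pow, hc, star_one], ?_⟩
    rw [Matrix.UnitaryGroup.inv_val, hU, Matrix.star_eq_conjTranspose,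
      Matrix.conjTranspose_smul, pauliString_star]

/-- The operator underlying an element of the Pauli group. -/
def mat {n : ℕ} (g : PauliGroup n) : Op n := ((g : Matrix.unitaryGroup (Idx n) ℂ) : Op n)

theorem mat_mul {n : ℕ} (g h : PauliGroup n) : mat (g * h) = mat g * mat h := rfl

theorem mat_one {n : ℕ} : mat (1 : PauliGroup n) = 1 := rfl

theorem mat_inv {n : ℕ} (g : PauliGroup n) : mat g⁻¹ = (mat g)ᴴ := rfl

instance {n : ℕ} : Finite (PauliGroup n) := by
  have hfin : {c : ℂ | c ^ 4 = 1}.Finite := by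
    refine (Polynomial.nthRoots 4 (1 : ℂ)).toFinset.finite_toSet.subset fun c hc => ?_
    simpa [Polynomial.mem_nthRoots] using hc
  have hset : {A : Op n | ∃ g : PauliGroup n, mat g = A}.Finite := by
    refine ((hfin.prod (Set.finite_univ (α := Fin n → Fin 4))).image
      fun z => z.1 • pauliString z.2).subset ?_
    rintro A ⟨g, rfl⟩
    obtain ⟨c, p, hc, hg⟩ := g.2
    exact ⟨(c, p), ⟨hc, Set.mem_univ _⟩, hg.symm⟩
  have : Finite {A : Op n | ∃ g : PauliGroup n, mat g = A} := hset.to_subtype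
  refine Finite.of_injective
    (fun g : PauliGroup n => (⟨mat g, g, rfl⟩ : {A : Op n | ∃ g : PauliGroup n, mat g = A})) ?_
  intro g h hgh
  have h1 := congrArg Subtype.val hgh
  exact Subtype.ext (Subtype.ext h1)

noncomputable instance {n : ℕ} (S : Subgroup (PauliGroup n)) : Fintype S := Fintype.ofFinite S

/-! ## Stabiliser codes -/

/-- `S` is the stabiliser of an `[n, k]` stabiliser code: an abelian subgroup of the Pauli group
which does not contain `-I` and has `n - k` independent generators, i.e. order `2 ^ (n - k)`. -/
structure IsStabilizer {n : ℕ} (S : Subgroup (PauliGroup n)) (k : ℕ) : Prop where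
  comm : ∀ s ∈ S, ∀ t ∈ S, s * t = t * s
  neg_one : ∀ s ∈ S, mat s ≠ -1
  le : k ≤ n
  card : Nat.card S = 2 ^ (n - k)

/-- The code space `𝒞` of vectors fixed by the stabiliser. -/
def codeSpace {n : ℕ} (S : Subgroup (PauliGroup n)) : Submodule ℂ (Idx n → ℂ) where
  carrier := {v | ∀ s ∈ S, mat s *ᵥ v = v}
  add_mem' hv hw s hs := by rw [Matrix.mulVec_add, hv s hs, hw s hs]
  zero_mem' s _ := Matrix.mulVec_zero _
  smul_mem' c v hv s hs := by rw [Matrix.mulVec_smul, hv s hs]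

/-- The orthogonal projector `P` onto the code space, as the average over the stabiliser. -/
noncomputable def codeProjector {n : ℕ} (S : Subgroup (PauliGroup n)) : Op n :=
  (Nat.card S : ℂ)⁻¹ • ∑ s : S, mat (s : PauliGroup n)

theorem mat_mul_codeProjector {n : ℕ} (S : Subgroup (PauliGroup n)) {s : PauliGroup n}
    (hs : s ∈ S) : mat s * codeProjector S = codeProjector S := by
  simp only [codeProjector, Matrix.mul_smul, Finset.mul_sum, ← mat_mul]
  congr 1
  exact Fintype.sum_equiv (Equiv.mulLeft (⟨s, hs⟩ : S)) _ _ fun t => rfl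

theorem codeProjector_isHermitian {n : ℕ} (S : Subgroup (PauliGroup n)) :
    (codeProjector S)ᴴ = codeProjector S := by
  simp only [codeProjector, Matrix.conjTranspose_smul, Matrix.conjTranspose_sum, ← mat_inv]
  congr 1
  · simp
  · exact Fintype.sum_equiv (Equiv.inv S) _ _ fun t => rfl

theorem codeProjector_mulVec_eq_iff {n : ℕ} (S : Subgroup (PauliGroup n)) (v : Idx n → ℂ) :
    codeProjector S *ᵥ v = v ↔ v ∈ codeSpace S := by
  constructor
  · intro h s hs
    rw [← h, Matrix.mulVec_mulVec, mat_mul_codeProjector S hs]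
  · intro h
    have hc : (Nat.card S : ℂ) ≠ 0 := Nat.cast_ne_zero.mpr Nat.card_pos.ne'
    rw [codeProjector, Matrix.smul_mulVec, Matrix.sum_mulVec,
      Finset.sum_congr rfl fun s _ => h s.1 s.2, Finset.sum_const, Finset.card_univ,
      ← Nat.card_eq_fintype_card, ← Nat.cast_smul_eq_nsmul ℂ, smul_smul, inv_mul_cancel₀ hc,
      one_smul]

theorem codeProjector_mul_self {n : ℕ} (S : Subgroup (PauliGroup n)) :
    codeProjector S * codeProjector S = codeProjector S := by
  have hc : (Nat.card S : ℂ) ≠ 0 := Nat.cast_ne_zero.mpr Nat.card_pos.ne'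
  conv_lhs => enter [1]; rw [codeProjector]
  rw [Matrix.smul_mul, Finset.sum_mul,
    Finset.sum_congr rfl fun s _ => mat_mul_codeProjector S s.2, Finset.sum_const,
    Finset.card_univ, ← Nat.card_eq_fintype_card, ← Nat.cast_smul_eq_nsmul ℂ, smul_smul,
    inv_mul_cancel₀ hc, one_smul]

/-- The normaliser `N(S)` of `S` in the Pauli group. -/
abbrev Normalizer {n : ℕ} (S : Subgroup (PauliGroup n)) : Subgroup (PauliGroup n) :=
  Subgroup.normalizer (S : Set (PauliGroup n))

/-- The group `N(S)/S` of logical operators. -/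
abbrev LogicalGroup {n : ℕ} (S : Subgroup (PauliGroup n)) : Type :=
  Normalizer S ⧸ S.subgroupOf (Normalizer S)

/-- A choice of isomorphism `𝒜` from the `k`-qubit Pauli group to `N(S)/S`. -/
abbrev LogicalIso {n : ℕ} (S : Subgroup (PauliGroup n)) (k : ℕ) : Type :=
  PauliGroup k ≃* LogicalGroup S

theorem normalizer_mulVec_mem {n : ℕ} (S : Subgroup (PauliGroup n)) (g : Normalizer S)
    {v : Idx n → ℂ} (hv : v ∈ codeSpace S) : mat (g : PauliGroup n) *ᵥ v ∈ codeSpace S := by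
  intro s hs
  have h1 : (g : PauliGroup n)⁻¹ * s * g ∈ S := (Subgroup.mem_normalizer_iff''.mp g.2 s).mp hs
  have h2 : s * (g : PauliGroup n) = g * ((g : PauliGroup n)⁻¹ * s * g) := by group
  rw [Matrix.mulVec_mulVec, ← mat_mul, h2, mat_mul, ← Matrix.mulVec_mulVec, hv _ h1]

/-- Elements of `N(S)` as linear maps on the code space. -/
noncomputable def normalizerAction {n : ℕ} (S : Subgroup (PauliGroup n)) :
    Normalizer S →* Module.End ℂ (codeSpace S) where
  toFun g := (Matrix.mulVecLin (mat (g : PauliGroup n))).restrict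
    fun _ hv => normalizer_mulVec_mem S g hv
  map_one' := by
    ext v : 2
    simp [mat_one]
  map_mul' g h := by
    ext v : 2
    exact (Matrix.mulVec_mulVec _ _ _).symm

/-- Elements of `N(S)/S` as linear maps on the code space. -/
noncomputable def logicalAction {n : ℕ} (S : Subgroup (PauliGroup n)) :
    LogicalGroup S →* Module.End ℂ (codeSpace S) :=
  QuotientGroup.lift _ (normalizerAction S) fun g hg => by
    ext v : 2
    exact v.2 _ (Subgroup.mem_subgroupOf.mp hg)

/-! ## Syndromes -/

/-- Syndromes, as the cosets of `N(S)` in the Pauli group. -/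
abbrev Syndrome {n : ℕ} (S : Subgroup (PauliGroup n)) : Type := PauliGroup n ⧸ Normalizer S

noncomputable instance {n : ℕ} (S : Subgroup (PauliGroup n)) : Fintype (Syndrome S) :=
  Fintype.ofFinite _

/-- `E_𝔫`: the errors in `E` which lie in the coset `𝔫`. -/
def errorsIn {n : ℕ} (S : Subgroup (PauliGroup n)) (E : Set (PauliGroup n)) (𝔫 : Syndrome S) :
    Set (PauliGroup n) :=
  {e | e ∈ E ∧ (e : Syndrome S) = 𝔫}

/-- `P_𝔫`: the projector `e P e†` onto the subspace `e 𝒞` of states with syndrome `𝔫`, where `e` is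
any element of `𝔫`. -/
noncomputable def syndromeProjector {n : ℕ} (S : Subgroup (PauliGroup n)) (𝔫 : Syndrome S) :
    Op n :=
  mat 𝔫.out * codeProjector S * (mat 𝔫.out)ᴴ

theorem normalizer_conj_codeProjector {n : ℕ} (S : Subgroup (PauliGroup n)) (g : Normalizer S) :
    mat (g : PauliGroup n) * codeProjector S * (mat (g : PauliGroup n))ᴴ = codeProjector S := by
  simp only [codeProjector, Matrix.mul_smul, Matrix.smul_mul, Finset.mul_sum, Finset.sum_mul,
    ← mat_inv, ← mat_mul]
  congr 1
  refine Fintype.sum_bijective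
    (fun s : S => (⟨g * s * (g : PauliGroup n)⁻¹,
      (Subgroup.mem_normalizer_iff.mp g.2 s).mp s.2⟩ : S)) ?_ _ _ fun s => rfl
  refine Finite.injective_iff_bijective.mp fun s t hst => Subtype.ext ?_
  simpa using congrArg Subtype.val hst

/-- The syndrome projector does not depend on the element of the coset. -/
theorem syndromeProjector_mk {n : ℕ} (S : Subgroup (PauliGroup n)) (e : PauliGroup n) :
    syndromeProjector S (e : Syndrome S) = mat e * codeProjector S * (mat e)ᴴ := by
  obtain ⟨g, hg⟩ := QuotientGroup.mk_out_eq_mul (Normalizer S) e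
  rw [syndromeProjector, hg, mat_mul, Matrix.conjTranspose_mul]
  conv_rhs => rw [← normalizer_conj_codeProjector S g]
  simp only [Matrix.mul_assoc]

/-! ## Channels -/

/-- The superoperator `σ ↦ K σ K†`. -/
def conjBy {n : ℕ} (K : Op n) : SuperOp n where
  toFun σ := K * σ * Kᴴ
  map_add' σ τ := by rw [Matrix.mul_add, Matrix.add_mul]
  map_smul' c σ := by simp

/-- `Φ` is the quantum channel with the (finitely many) Kraus operators `K a`:
`Φ σ = ∑ a, K a σ (K a)†` and `∑ a, (K a)† (K a) = 1`. -/
def IsChannelWithKraus {n : ℕ} (Φ : SuperOp n) {ι : Type} [Fintype ι] (K : ι → Op n) : Prop :=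
  Φ = ∑ a, conjBy (K a) ∧ ∑ a, (K a)ᴴ * K a = 1

/-- `Φ` is a quantum channel, i.e. completely positive and trace preserving. -/
def IsChannel {n : ℕ} (Φ : SuperOp n) : Prop :=
  ∃ (d : ℕ) (K : Fin d → Op n), IsChannelWithKraus Φ K

/-- `ρ` is a density operator with support in the code space. -/
structure IsCodeState {n : ℕ} (S : Subgroup (PauliGroup n)) (ρ : Op n) : Prop where
  posSemidef : ρ.PosSemidef
  trace : ρ.trace = 1
  support : codeProjector S * ρ * codeProjector S = ρ

/-- A physical noise channel: its Kraus operators are proportional to elements of `E`. -/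
def IsPhysicalNoise {n : ℕ} (E : Set (PauliGroup n)) (Φ : SuperOp n) : Prop :=
  ∃ (d : ℕ) (K : Fin d → Op n), IsChannelWithKraus Φ K ∧
    ∀ a, ∃ e ∈ E, ∃ c : ℂ, K a = c • mat e

/-- An admissible logical noise channel (ALNC): it stabilises the code space, and its Kraus
operators are proportional to elements of the cosets `𝒜 m`, `m ∈ M`, of `S` in `N(S)`. -/
def IsALNC {n k : ℕ} (S : Subgroup (PauliGroup n)) (M : Set (PauliGroup k)) (A : LogicalIso S k)
    (Λ : SuperOp n) : Prop :=
  (∃ (d : ℕ) (K : Fin d → Op n), IsChannelWithKraus Λ K ∧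
    ∀ a, ∃ m ∈ M, ∃ g : Normalizer S, (g : LogicalGroup S) = A m ∧
      ∃ c : ℂ, K a = c • mat (g : PauliGroup n)) ∧
  ∀ ρ, IsCodeState S ρ → IsCodeState S (Λ ρ)

/-! ## Quantum error transmutation -/

/-- The operation `R` transmutes every physical noise channel with errors in `E` to an ALNC with
logical errors in `M`, with respect to the isomorphism `A`. -/
def IsTransmuting {n k : ℕ} (S : Subgroup (PauliGroup n)) (E : Set (PauliGroup n))
    (M : Set (PauliGroup k)) (A : LogicalIso S k) (R : SuperOp n) : Prop :=
  IsChannel R ∧ ∀ Φ, IsPhysicalNoise E Φ →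
    ∃ Λ, IsALNC S M A Λ ∧ ∀ ρ, IsCodeState S ρ → R (Φ ρ) = Λ ρ

/-- The code is a quantum error transmuting code for the pair `(E, M)`. -/
def IsQETCode {n k : ℕ} (S : Subgroup (PauliGroup n)) (E : Set (PauliGroup n))
    (M : Set (PauliGroup k)) : Prop :=
  ∃ (A : LogicalIso S k) (R : SuperOp n), IsTransmuting S E M A R

/-- The maps `π : E_𝔫 → 𝒜(M)`. -/
abbrev ErrorMap {n k : ℕ} (S : Subgroup (PauliGroup n)) (E : Set (PauliGroup n))
    (M : Set (PauliGroup k)) (A : LogicalIso S k) (𝔫 : Syndrome S) : Type :=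
  errorsIn S E 𝔫 → (A '' M : Set (LogicalGroup S))

/-- `E_i† E_j |_𝒞 = (π E_i)† (π E_j)` for all `E_i, E_j ∈ E_𝔫`, as linear maps on `𝒞` and up to a
global phase in `{1, -1, i, -i}`; the adjoint of the action of `π E_i` is that of its inverse. -/
def PreservesBilinears {n k : ℕ} {S : Subgroup (PauliGroup n)} {E : Set (PauliGroup n)}
    {M : Set (PauliGroup k)} {A : LogicalIso S k} {𝔫 : Syndrome S}
    (π : ErrorMap S E M A 𝔫) : Prop :=
  ∀ e f : errorsIn S E 𝔫, ∃ c : ℂ, c ^ 4 = 1 ∧ ∀ v : codeSpace S,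
    ((mat (e : PauliGroup n))ᴴ * mat (f : PauliGroup n)) *ᵥ (v : Idx n → ℂ) =
      c • ((logicalAction S ((π e : LogicalGroup S)⁻¹ * (π f : LogicalGroup S)) v :
        codeSpace S) : Idx n → ℂ)

/-- `E_i† E_j P = m_i† m_j P` for all `E_i, E_j ∈ E_𝔫`, up to a global phase in `{1, -1, i, -i}`,
where `m_i, m_j ∈ N(S)` represent `π E_i` and `π E_j`. -/
def PreservesBilinearsRep {n k : ℕ} {S : Subgroup (PauliGroup n)} {E : Set (PauliGroup n)}
    {M : Set (PauliGroup k)} {A : LogicalIso S k} {𝔫 : Syndrome S}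
    (π : ErrorMap S E M A 𝔫) : Prop :=
  ∀ (e f : errorsIn S E 𝔫) (a b : Normalizer S),
    (a : LogicalGroup S) = π e → (b : LogicalGroup S) = π f →
    ∃ c : ℂ, c ^ 4 = 1 ∧
      (mat (e : PauliGroup n))ᴴ * mat (f : PauliGroup n) * codeProjector S =
        c • ((mat (a : PauliGroup n))ᴴ * mat (b : PauliGroup n) * codeProjector S)

/-! ## The recovery protocol -/

/-- The maps `π : E_𝔫 → 𝒜(M)` which preserve bilinears. -/
abbrev TransmutingMap {n k : ℕ} (S : Subgroup (PauliGroup n)) (E : Set (PauliGroup n))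
    (M : Set (PauliGroup k)) (A : LogicalIso S k) (𝔫 : Syndrome S) : Type :=
  {π : ErrorMap S E M A 𝔫 // PreservesBilinears π}

noncomputable instance {n k : ℕ} (S : Subgroup (PauliGroup n)) (E : Set (PauliGroup n))
    (M : Set (PauliGroup k)) (A : LogicalIso S k) (𝔫 : Syndrome S) :
    Fintype (TransmutingMap S E M A 𝔫) :=
  Fintype.ofFinite _

/-- For each syndrome, a probability distribution over the maps `π` which preserve bilinears. -/
def IsDistribution {n k : ℕ} {S : Subgroup (PauliGroup n)} {E : Set (PauliGroup n)}
    {M : Set (PauliGroup k)} {A : LogicalIso S k}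
    (r : ∀ 𝔫, TransmutingMap S E M A 𝔫 → ℝ) : Prop :=
  ∀ 𝔫, (∀ π, 0 ≤ r 𝔫 π) ∧ ∑ π, r 𝔫 π = 1

/-- The syndrome measurement `σ ↦ ∑ 𝔫, P_𝔫 σ P_𝔫` (with the outcome forgotten). -/
noncomputable def syndromeMeasurement {n : ℕ} (S : Subgroup (PauliGroup n)) : SuperOp n :=
  ∑ 𝔫, conjBy (syndromeProjector S 𝔫)

open Classical in
/-- Syndrome measurement followed by a syndrome-dependent recovery. On outcome `𝔫`, if `E_𝔫` is
nonempty with reference error `e = ref 𝔫`, draw `π` with probability `r 𝔫 π` and apply `m e†`, where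
`m = rep (π e)` represents `π e`. If no error has syndrome `𝔫`, apply the operation `Q 𝔫`. -/
noncomputable def protocol {n k : ℕ} {S : Subgroup (PauliGroup n)} {E : Set (PauliGroup n)}
    {M : Set (PauliGroup k)} {A : LogicalIso S k}
    (ref : ∀ 𝔫, (errorsIn S E 𝔫).Nonempty → errorsIn S E 𝔫)
    (rep : LogicalGroup S → Normalizer S)
    (r : ∀ 𝔫, TransmutingMap S E M A 𝔫 → ℝ) (Q : Syndrome S → SuperOp n) : SuperOp n :=
  ∑ 𝔫, (if h : (errorsIn S E 𝔫).Nonempty then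
      ∑ π : TransmutingMap S E M A 𝔫, (r 𝔫 π : ℂ) •
        conjBy (mat (rep (π.1 (ref 𝔫 h)) : PauliGroup n) *
          (mat (ref 𝔫 h : PauliGroup n))ᴴ)
    else Q 𝔫) ∘ₗ conjBy (syndromeProjector S 𝔫)

end QET

open QET

namespace QET

open Matrix
open scoped ComplexOrder

/-! ## Pauli operators -/

/-! Everything is done modulo `PhaseEq`: two Pauli operators agree on the code up to a phase in {±1,
±i}. Conjugation of operators on the code cannot see such a phase, and Pauli operators that are not
`PhaseEq` are orthogonal on the code for the Hilbert–Schmidt inner product. A mixture of Pauli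
conjugations on the code therefore determines which classes occur in it
(`exists_phaseEq_of_sum_eq`).

Let R be transmuting and e an error with syndrome 𝔫. On eρe†, R produces a mixture of logical
operators g_a with weights w_a. Any other error f with this syndrome is f = e x with x = e⁻¹f in
N(S), so on fρf† the same R produces the mixture of the g_a x. That must also be a mixture of
admissible operators, so each g_a x with w_a ≠ 0 is admissible up to phase. Hence each such a yields
a whole map π_a : f ↦ g_a e⁻¹ f, and the factor g_a e⁻¹ cancels in bilinears
(`IsTransmuting.exists_transmutingMap`). Grouping the weights by π_a gives the distribution r.

Conversely, if π preserves bilinears and m represents π(e), then m e† sends f to a representative of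
π(f), up to phase, for every f with the same syndrome (`PreservesBilinears.phaseEq`). The recovery
thus needs only the reference error. The syndrome projectors sum to 1 because Pauli operators
permute them and only scalars commute with all Pauli operators; -I ∉ S enters through tr P ≠ 0. -/

theorem trace_tensor {n : ℕ} (A : Fin n → Matrix (Fin 2) (Fin 2) ℂ) :
    (tensor A).trace = ∏ i, (A i).trace := by
  simp only [Matrix.trace, tensor, Matrix.diag_apply, Matrix.of_apply]
  rw [Fintype.prod_sum]

theorem trace_pauli_of_ne_zero {p : Fin 4} (hp : p ≠ 0) : (pauli p).trace = 0 := by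
  fin_cases p
  · exact absurd rfl hp
  all_goals simp [pauli, Matrix.trace, Fin.sum_univ_two]

theorem pauli_mul_self (p : Fin 4) : pauli p * pauli p = 1 := by
  fin_cases p <;> simp [pauli, Matrix.one_fin_two]

theorem pauli_commute_or_anticommute (p q : Fin 4) :
    ∃ ε : ℂ, ε ^ 2 = 1 ∧ pauli p * pauli q = ε • (pauli q * pauli p) := by
  fin_cases p <;> fin_cases q <;>
    first
    | (refine ⟨1, by norm_num, ?_⟩; simp [pauli]; done)
    | (refine ⟨-1, by norm_num, ?_⟩; simp [pauli])

theorem pauliString_mul_self {n : ℕ} (p : Fin n → Fin 4) : pauliString p * pauliString p = 1 := by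
  simp only [pauliString, tensor_mul, pauli_mul_self, tensor_one]

/-- The Pauli string with label `p i` on qubit `i`, as an element of the Pauli group. -/
def pauliElement {n : ℕ} (p : Fin n → Fin 4) : PauliGroup n :=
  ⟨⟨pauliString p, by
    rw [Matrix.mem_unitaryGroup_iff, Matrix.star_eq_conjTranspose, pauliString_star,
      pauliString_mul_self]⟩, 1, p, by simp, by simp⟩

theorem mat_injective {n : ℕ} : Function.Injective (mat : PauliGroup n → Op n) :=
  fun _ _ h => Subtype.ext (Subtype.ext h)

theorem conjTranspose_mat_mul_mat {n : ℕ} (g : PauliGroup n) : (mat g)ᴴ * mat g = 1 := by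
  rw [← mat_inv, ← mat_mul, inv_mul_cancel, mat_one]

theorem mat_commute_or_anticommute {n : ℕ} (g h : PauliGroup n) :
    mat g * mat h = mat h * mat g ∨ mat g * mat h = -(mat h * mat g) := by
  obtain ⟨c, p, -, hg⟩ := g.2
  obtain ⟨d, q, -, hh⟩ := h.2
  change mat g = _ at hg
  change mat h = _ at hh
  choose ε hε hpq using fun i => pauli_commute_or_anticommute (p i) (q i)
  have h1 : mat g * mat h = (∏ i, ε i) • (mat h * mat g) := by
    rw [hg, hh]
    simp only [pauliString, Matrix.smul_mul, Matrix.mul_smul, tensor_mul, hpq, tensor_smul,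
      smul_smul]
    congr 1
    ring
  have h2 : (∏ i, ε i) ^ 2 = 1 := by
    rw [← Finset.prod_pow]
    simp [hε]
  rcases mul_self_eq_one_iff.mp ((sq _).symm.trans h2) with h | h
  · left; rw [h1, h, one_smul]
  · right; rw [h1, h, neg_one_smul]

/-- A Pauli operator is either traceless or a phase. -/
theorem mat_eq_smul_one_or_trace_eq_zero {n : ℕ} (g : PauliGroup n) :
    (∃ c : ℂ, c ^ 4 = 1 ∧ mat g = c • (1 : Op n)) ∨ (mat g).trace = 0 := by
  obtain ⟨c, p, hc, hg⟩ := g.2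
  change mat g = _ at hg
  by_cases hp : ∀ i, p i = 0
  · left
    refine ⟨c, hc, ?_⟩
    rw [hg, pauliString]
    simp only [hp, pauli_zero, tensor_one]
  · right
    push Not at hp
    obtain ⟨i, hi⟩ := hp
    rw [hg, Matrix.trace_smul, pauliString, trace_tensor,
      Finset.prod_eq_zero (Finset.mem_univ i) (trace_pauli_of_ne_zero hi), smul_zero]

/-- Only scalars commute with every Pauli operator. -/
theorem eq_smul_one_of_commute_mat {n : ℕ} (X : Op n)
    (hX : ∀ g : PauliGroup n, mat g * X = X * mat g) : ∃ c : ℂ, X = c • (1 : Op n) := by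
  have key (p : Fin n → Fin 4) : pauliString p * X = X * pauliString p := hX (pauliElement p)
  have off (x y : Idx n) (hxy : x ≠ y) : X x y = 0 := by
    obtain ⟨i, hi⟩ := Function.ne_iff.mp hxy
    -- Z on a qubit where x and y differ has opposite signs at x and y, so commuting with it kills
    -- the entry X x y.
    have hZ : pauliString (fun j => if j = i then 3 else 0) =
        Matrix.diagonal fun z : Idx n => if z i = 0 then (1 : ℂ) else -1 := by
      ext a b
      rw [Matrix.diagonal_apply]
      simp only [pauliString, tensor, Matrix.of_apply]
      split_ifs with hab hai
      · subst hab
        refine Finset.prod_eq_one fun j _ => ?_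
        split_ifs with hj
        · subst hj; rw [hai]; simp [pauli]
        · rw [pauli_zero]; simp
      · subst hab
        rw [Finset.prod_eq_single i]
        · have : a i = 1 := by omega
          rw [this]; simp [pauli]
        · intro j _ hj
          rw [if_neg hj, pauli_zero]; simp
        · simp
      · obtain ⟨j, hj⟩ := Function.ne_iff.mp hab
        refine Finset.prod_eq_zero (Finset.mem_univ j) ?_
        generalize a j = u at *
        generalize b j = v at *
        split_ifs <;> fin_cases u <;> fin_cases v <;> simp_all [pauli]
    have h := congrFun (congrFun (key fun j => if j = i then 3 else 0) x) y
    rw [hZ, Matrix.diagonal_mul, Matrix.mul_diagonal] at h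
    have h2 : (2 : ℂ) * X x y = 0 := by
      by_cases h0 : x i = 0
      · have h1 : y i ≠ 0 := fun h => hi (h0.trans h.symm)
        simp only [h0, h1, if_true, if_false] at h
        linear_combination h
      · have h1 : y i = 0 := by omega
        simp only [h0, h1, if_true, if_false] at h
        linear_combination -h
    simpa using h2
  have diag (x y : Idx n) : X x x = X y y := by
    -- The string with X on the qubits where x and y differ exchanges the basis vectors x and y,
    -- which forces equal diagonal entries.
    have hP : pauliString (fun j => if x j = y j then 0 else 1) x y = 1 := by
      simp only [pauliString, tensor, Matrix.of_apply]
      refine Finset.prod_eq_one fun j _ => ?_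
      generalize x j = u
      generalize y j = v
      fin_cases u <;> fin_cases v <;> simp [pauli]
    have h := congrFun (congrFun (key fun j => if x j = y j then 0 else 1) x) y
    rw [Matrix.mul_apply, Matrix.mul_apply,
      Finset.sum_eq_single y (fun z _ hz => by rw [off z y hz, mul_zero]) (by simp),
      Finset.sum_eq_single x (fun z _ hz => by rw [off x z hz.symm, zero_mul]) (by simp),
      hP, one_mul, mul_one] at h
    exact h.symm
  refine ⟨X (fun _ => 0) (fun _ => 0), ?_⟩
  ext x y
  rw [Matrix.smul_apply, Matrix.one_apply]
  split_ifs with h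
  · subst h; simpa using diag _ _
  · simpa using off x y h

/-! ## The projectors onto the syndrome subspaces -/

theorem codeProjector_mul_mat {n : ℕ} (S : Subgroup (PauliGroup n)) {s : PauliGroup n}
    (hs : s ∈ S) : codeProjector S * mat s = codeProjector S := by
  have h := congrArg Matrix.conjTranspose (mat_mul_codeProjector S (inv_mem hs))
  rwa [Matrix.conjTranspose_mul, codeProjector_isHermitian, mat_inv,
    Matrix.conjTranspose_conjTranspose] at h

/-- A Pauli operator acts on the code space as a phase, or its compression is traceless. -/
theorem mul_codeProjector_eq_smul_or_trace_eq_zero {n : ℕ} (S : Subgroup (PauliGroup n))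
    (g : PauliGroup n) :
    (∃ c : ℂ, c ^ 4 = 1 ∧ mat g * codeProjector S = c • codeProjector S) ∨
      (mat g * codeProjector S).trace = 0 := by
  -- If no product g s with s ∈ S is a phase, every term of g P, expanded as an average over S, is
  -- traceless.
  by_cases h : ∃ s ∈ S, ∃ c : ℂ, c ^ 4 = 1 ∧ mat (g * s) = c • (1 : Op n)
  · obtain ⟨s, hs, c, hc, h⟩ := h
    refine Or.inl ⟨c, hc, ?_⟩
    rw [← mat_mul_codeProjector S hs, ← Matrix.mul_assoc, ← mat_mul, h,
      Matrix.smul_mul, Matrix.one_mul, mat_mul_codeProjector S hs]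
  · right
    push Not at h
    rw [codeProjector, Matrix.mul_smul, Matrix.trace_smul, Finset.mul_sum, Matrix.trace_sum,
      Finset.sum_eq_zero, smul_zero]
    intro s _
    rw [← mat_mul]
    refine (mat_eq_smul_one_or_trace_eq_zero _).resolve_left ?_
    rintro ⟨c, hc, hg⟩
    exact h s s.2 c hc hg

/-- Only the identity contributes to the trace of the average. Any other s with nonzero trace would
be c·I with c⁴ = 1 and c ≠ 1, so that s or s² would be -I. -/
theorem trace_codeProjector_ne_zero {n : ℕ} {S : Subgroup (PauliGroup n)}
    (hS : ∀ s ∈ S, mat s ≠ -1) : (codeProjector S).trace ≠ 0 := by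
  have hc : (Nat.card S : ℂ) ≠ 0 := Nat.cast_ne_zero.mpr Nat.card_pos.ne'
  rw [codeProjector, Matrix.trace_smul, Matrix.trace_sum, Finset.sum_eq_single 1]
  · simp [mat_one]
  · intro s _ hs
    refine (mat_eq_smul_one_or_trace_eq_zero _).resolve_left ?_
    rintro ⟨c, hc, hg⟩
    have h2 : mat (s.1 * s.1) = (c * c) • (1 : Op n) := by
      rw [mat_mul, hg, Matrix.smul_mul, Matrix.one_mul, smul_smul]
    have h3 : (c * c) * (c * c) = 1 := by rw [← hc]; ring
    rcases mul_self_eq_one_iff.mp h3 with h | h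
    · rcases mul_self_eq_one_iff.mp h with h | h
      · refine hs (Subtype.ext (mat_injective ?_))
        rw [hg, h, one_smul]; rfl
      · exact hS s s.2 (by rw [hg, h, neg_one_smul])
    · exact hS (s.1 * s.1) (mul_mem s.2 s.2) (by rw [h2, h, neg_one_smul])
  · simp

/-- An element commuting with all of S would normalise it, so g anticommutes with some s ∈ S.
Absorbing s into P on either side gives P g P = -P g P. -/
theorem codeProjector_mul_mat_mul_codeProjector_eq_zero {n : ℕ} (S : Subgroup (PauliGroup n))
    {g : PauliGroup n} (hg : g ∉ Normalizer S) :
    codeProjector S * mat g * codeProjector S = 0 := by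
  have h : ∃ s ∈ S, mat g * mat s = -(mat s * mat g) := by
    by_contra! h
    have h1 : ∀ s ∈ S, g * s = s * g := fun s hs =>
      mat_injective ((mat_commute_or_anticommute g s).resolve_right (h s hs))
    refine hg (Subgroup.mem_normalizer_iff.mpr fun s => ⟨fun hs => ?_, fun hs => ?_⟩)
    · rwa [h1 s hs, mul_inv_cancel_right]
    · have h2 := h1 _ hs
      have h3 : s = g * s * g⁻¹ := by
        apply mul_left_cancel (a := g)
        rw [h2]; group
      rwa [h3]
  obtain ⟨s, hs, h⟩ := h
  have h1 : codeProjector S * mat g * codeProjector S =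
      -(codeProjector S * mat g * codeProjector S) :=
    calc codeProjector S * mat g * codeProjector S
        = codeProjector S * (mat g * mat s) * codeProjector S := by
          rw [Matrix.mul_assoc, Matrix.mul_assoc, Matrix.mul_assoc (mat g),
            mat_mul_codeProjector S hs]
      _ = -(codeProjector S * mat g * codeProjector S) := by
          rw [h, Matrix.mul_neg, ← Matrix.mul_assoc, codeProjector_mul_mat S hs, Matrix.neg_mul]
  have h2 : (2 : ℂ) • (codeProjector S * mat g * codeProjector S) = 0 := by
    rw [two_smul]
    nth_rewrite 1 [h1]
    exact neg_add_cancel _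
  exact (smul_eq_zero.mp h2).resolve_left two_ne_zero

theorem syndromeProjector_isHermitian {n : ℕ} (S : Subgroup (PauliGroup n)) (𝔫 : Syndrome S) :
    (syndromeProjector S 𝔫)ᴴ = syndromeProjector S 𝔫 := by
  simp only [syndromeProjector, Matrix.conjTranspose_mul, Matrix.conjTranspose_conjTranspose,
    codeProjector_isHermitian, Matrix.mul_assoc]

theorem syndromeProjector_mul_mat {n : ℕ} (S : Subgroup (PauliGroup n)) (e : PauliGroup n) :
    syndromeProjector S (e : Syndrome S) * mat e = mat e * codeProjector S := by
  rw [syndromeProjector_mk, Matrix.mul_assoc, conjTranspose_mat_mul_mat, Matrix.mul_one]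

theorem syndromeProjector_mul_self {n : ℕ} (S : Subgroup (PauliGroup n)) (𝔫 : Syndrome S) :
    syndromeProjector S 𝔫 * syndromeProjector S 𝔫 = syndromeProjector S 𝔫 := by
  obtain ⟨e, rfl⟩ := QuotientGroup.mk_surjective 𝔫
  conv_lhs => rw [syndromeProjector_mk S e, ← Matrix.mul_assoc, ← Matrix.mul_assoc,
    ← syndromeProjector_mk, syndromeProjector_mul_mat]
  rw [Matrix.mul_assoc (mat e), codeProjector_mul_self, syndromeProjector_mk]

theorem syndromeProjector_mul_mat_mul_codeProjector {n : ℕ} (S : Subgroup (PauliGroup n))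
    {𝔫 : Syndrome S} {e : PauliGroup n} (h : (e : Syndrome S) ≠ 𝔫) :
    syndromeProjector S 𝔫 * mat e * codeProjector S = 0 := by
  obtain ⟨f, rfl⟩ := QuotientGroup.mk_surjective 𝔫
  have hf : f⁻¹ * e ∉ Normalizer S := fun hf => h (QuotientGroup.eq.mpr hf).symm
  have h0 := codeProjector_mul_mat_mul_codeProjector_eq_zero S hf
  rw [mat_mul] at h0
  rw [syndromeProjector_mk, ← mat_inv]
  simp only [Matrix.mul_assoc] at h0 ⊢
  rw [h0, Matrix.mul_zero]

noncomputable instance {n : ℕ} (S : Subgroup (PauliGroup n)) :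
    MulAction (PauliGroup n) (Syndrome S) :=
  MulAction.quotient (PauliGroup n) (Normalizer S)

theorem mat_mul_syndromeProjector {n : ℕ} (S : Subgroup (PauliGroup n)) (g : PauliGroup n)
    (𝔫 : Syndrome S) :
    mat g * syndromeProjector S 𝔫 = syndromeProjector S (g • 𝔫) * mat g := by
  obtain ⟨e, rfl⟩ := QuotientGroup.mk_surjective 𝔫
  have : g • (e : Syndrome S) = ((g * e : PauliGroup n) : Syndrome S) := rfl
  rw [this, syndromeProjector_mk, syndromeProjector_mk, mat_mul, Matrix.conjTranspose_mul]
  simp only [Matrix.mul_assoc, conjTranspose_mat_mul_mat, Matrix.mul_one]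

/-- The syndrome projectors are a resolution of the identity. -/
theorem sum_syndromeProjector {n : ℕ} {S : Subgroup (PauliGroup n)}
    (hS : ∀ s ∈ S, mat s ≠ -1) : ∑ 𝔫, syndromeProjector S 𝔫 = 1 := by
  -- Left multiplication by g permutes the syndromes, so the sum commutes with every Pauli operator
  -- and is a scalar. Testing it against P shows that the scalar is 1.
  obtain ⟨c, hc⟩ := eq_smul_one_of_commute_mat (∑ 𝔫, syndromeProjector S 𝔫) fun g => by
    rw [Finset.mul_sum, Finset.sum_mul]
    exact Fintype.sum_bijective (g • ·) (MulAction.bijective g) _ _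
      fun 𝔫 => mat_mul_syndromeProjector S g 𝔫
  have h1 : (∑ 𝔫, syndromeProjector S 𝔫) * codeProjector S = codeProjector S := by
    rw [Finset.sum_mul, Finset.sum_eq_single ((1 : PauliGroup n) : Syndrome S)]
    · rw [syndromeProjector_mk, mat_one, Matrix.one_mul, Matrix.conjTranspose_one, Matrix.mul_one,
        codeProjector_mul_self]
    · intro 𝔫 _ h
      simpa [mat_one] using syndromeProjector_mul_mat_mul_codeProjector S (e := 1) h.symm
    · simp
  rw [hc, Matrix.smul_mul, Matrix.one_mul] at h1
  have h2 : c * (codeProjector S).trace = (codeProjector S).trace := by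
    rw [← smul_eq_mul, ← Matrix.trace_smul, h1]
  rw [hc, mul_right_cancel₀ (trace_codeProjector_ne_zero hS) (h2.trans (one_mul _).symm), one_smul]

theorem normalizer_mat_mul_codeProjector {n : ℕ} (S : Subgroup (PauliGroup n))
    (g : Normalizer S) :
    mat (g : PauliGroup n) * codeProjector S = codeProjector S * mat (g : PauliGroup n) := by
  conv_rhs => rw [← normalizer_conj_codeProjector S g, Matrix.mul_assoc,
    conjTranspose_mat_mul_mat, Matrix.mul_one]

/-! ## Pauli operators with the same action on the code space up to a phase -/

/-- `g` and `h` have the same action on the code space, up to a phase in `{1, -1, i, -i}`. -/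
def PhaseEq {n : ℕ} (S : Subgroup (PauliGroup n)) (g h : PauliGroup n) : Prop :=
  ∃ c : ℂ, c ^ 4 = 1 ∧ mat g * codeProjector S = c • (mat h * codeProjector S)

theorem mul_star_self_of_pow_four {c : ℂ} (hc : c ^ 4 = 1) : c * star c = 1 := by
  have h : ‖c‖ = 1 := Complex.norm_eq_one_of_pow_eq_one hc (by norm_num)
  rw [Complex.star_def, Complex.mul_conj, Complex.normSq_eq_norm_sq, h]
  norm_num

namespace PhaseEq

variable {n : ℕ} {S : Subgroup (PauliGroup n)} {g h k : PauliGroup n}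

theorem symm (H : PhaseEq S g h) : PhaseEq S h g := by
  obtain ⟨c, hc, H⟩ := H
  refine ⟨star c, by rw [← star_pow, hc, star_one], ?_⟩
  rw [H, smul_smul, mul_comm, mul_star_self_of_pow_four hc, one_smul]

theorem trans (H : PhaseEq S g h) (H' : PhaseEq S h k) : PhaseEq S g k := by
  obtain ⟨c, hc, H⟩ := H
  obtain ⟨d, hd, H'⟩ := H'
  exact ⟨c * d, by rw [mul_pow, hc, hd, one_mul], by rw [H, H', smul_smul]⟩

theorem mul_left (H : PhaseEq S g h) (k : PauliGroup n) : PhaseEq S (k * g) (k * h) := by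
  obtain ⟨c, hc, H⟩ := H
  exact ⟨c, hc, by rw [mat_mul, Matrix.mul_assoc, H, mat_mul, Matrix.mul_smul, Matrix.mul_assoc]⟩

/-- The factor k has to be moved past P, and elements of N(S) commute with P. -/
theorem mul_right (H : PhaseEq S g h) {k : PauliGroup n} (hk : k ∈ Normalizer S) :
    PhaseEq S (g * k) (h * k) := by
  obtain ⟨c, hc, H⟩ := H
  have hk := normalizer_mat_mul_codeProjector S ⟨k, hk⟩
  refine ⟨c, hc, ?_⟩
  rw [mat_mul, mat_mul, Matrix.mul_assoc, hk, ← Matrix.mul_assoc, H, Matrix.smul_mul,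
    Matrix.mul_assoc (mat h), ← hk, Matrix.mul_assoc]

theorem inv (H : PhaseEq S g h) (hh : h ∈ Normalizer S) :
    PhaseEq S g⁻¹ h⁻¹ := by
  -- Multiplying by g⁻¹ on the left and h⁻¹ on the right turns g ~ h into h⁻¹ ~ g⁻¹.
  have h1 := ((H.mul_left g⁻¹).mul_right (inv_mem hh)).symm
  simpa [mul_assoc] using h1

theorem conjBy_eq (H : PhaseEq S g h) (X : Op n) :
    conjBy (mat g) (codeProjector S * X * codeProjector S) =
      conjBy (mat h) (codeProjector S * X * codeProjector S) := by
  obtain ⟨c, hc, H⟩ := H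
  have key (a : PauliGroup n) : conjBy (mat a) (codeProjector S * X * codeProjector S) =
      (mat a * codeProjector S) * X * (mat a * codeProjector S)ᴴ := by
    simp only [conjBy, LinearMap.coe_mk, AddHom.coe_mk, Matrix.conjTranspose_mul,
      codeProjector_isHermitian, Matrix.mul_assoc]
  rw [key, key, H, Matrix.conjTranspose_smul, Matrix.smul_mul, Matrix.mul_smul, Matrix.smul_mul,
    smul_smul, mul_comm, mul_star_self_of_pow_four hc, one_smul]

theorem of_coe_eq {a b : Normalizer S} (H : (a : LogicalGroup S) = b) : PhaseEq S a b := by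
  have h1 : (a : PauliGroup n)⁻¹ * b ∈ S := Subgroup.mem_subgroupOf.mp (QuotientGroup.eq.mp H)
  refine ⟨1, one_pow _, ?_⟩
  rw [one_smul, ← mat_mul_codeProjector S h1, ← Matrix.mul_assoc, ← mat_mul, mul_inv_cancel_left,
    mat_mul_codeProjector S h1]

end PhaseEq

/-- The trace is the Hilbert–Schmidt inner product of h P and g P, so this is the orthogonality of
inequivalent Pauli operators on the code. -/
theorem phaseEq_or_trace_eq_zero {n : ℕ} (S : Subgroup (PauliGroup n)) (g h : PauliGroup n) :
    PhaseEq S g h ∨ ((mat h)ᴴ * mat g * codeProjector S).trace = 0 := by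
  rw [← mat_inv, ← mat_mul]
  refine (mul_codeProjector_eq_smul_or_trace_eq_zero S (h⁻¹ * g)).imp_left ?_
  rintro ⟨c, hc, H⟩
  refine ⟨c, hc, ?_⟩
  rw [← Matrix.mul_smul, ← H, ← Matrix.mul_assoc, ← mat_mul, mul_inv_cancel_left]

/-! ## Channels -/

theorem conjBy_apply {n : ℕ} (K σ : Op n) : conjBy K σ = K * σ * Kᴴ := rfl

theorem conjBy_mul {n : ℕ} (K L : Op n) : conjBy (K * L) = conjBy K ∘ₗ conjBy L := by
  ext1 σ
  simp only [conjBy_apply, LinearMap.comp_apply, Matrix.conjTranspose_mul, Matrix.mul_assoc]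

theorem conjBy_smul {n : ℕ} (c : ℂ) (K : Op n) :
    conjBy (c • K) = ((‖c‖ ^ 2 : ℝ) : ℂ) • conjBy K := by
  ext1 σ
  simp only [conjBy_apply, LinearMap.smul_apply, Matrix.conjTranspose_smul, Matrix.smul_mul,
    Matrix.mul_smul, smul_smul]
  rw [mul_comm, Complex.star_def, Complex.mul_conj, Complex.normSq_eq_norm_sq]

theorem conjTranspose_smul_mat_mul_smul_mat {n : ℕ} (c : ℂ) (g : PauliGroup n) :
    (c • mat g)ᴴ * (c • mat g) = ((‖c‖ ^ 2 : ℝ) : ℂ) • (1 : Op n) := by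
  rw [Matrix.conjTranspose_smul, Matrix.smul_mul, Matrix.mul_smul, smul_smul,
    conjTranspose_mat_mul_mat, mul_comm, Complex.star_def, Complex.mul_conj,
    Complex.normSq_eq_norm_sq]

/-- The weights of Kraus operators proportional to Pauli operators sum to one. -/
theorem sum_norm_sq_eq_one {n : ℕ} {ι : Type} [Fintype ι] {c : ι → ℂ} {g : ι → PauliGroup n}
    (h : ∑ a, (c a • mat (g a))ᴴ * (c a • mat (g a)) = 1) : ∑ a, ‖c a‖ ^ 2 = 1 := by
  simp only [conjTranspose_smul_mat_mul_smul_mat, ← Finset.sum_smul] at h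
  have h1 := congrFun (congrFun h (fun _ => 0)) (fun _ => 0)
  simp only [Matrix.smul_apply, Matrix.one_apply_eq, smul_eq_mul, mul_one] at h1
  exact_mod_cast h1

/-- The Kraus operators of a channel may be indexed by any finite type. -/
theorem IsChannelWithKraus.exists_fin {n : ℕ} {Φ : SuperOp n} {ι : Type} [Fintype ι]
    {K : ι → Op n} (h : IsChannelWithKraus Φ K) :
    ∃ (d : ℕ) (f : Fin d → ι), IsChannelWithKraus Φ (K ∘ f) := by
  refine ⟨Fintype.card ι, (Fintype.equivFin ι).symm, ?_, ?_⟩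
  · rw [h.1]
    exact (Equiv.sum_comp (Fintype.equivFin ι).symm fun a => conjBy (K a)).symm
  · rw [← h.2]
    exact Equiv.sum_comp (Fintype.equivFin ι).symm fun a => (K a)ᴴ * K a

theorem IsChannelWithKraus.isChannel {n : ℕ} {Φ : SuperOp n} {ι : Type} [Fintype ι]
    {K : ι → Op n} (h : IsChannelWithKraus Φ K) : IsChannel Φ := by
  obtain ⟨d, f, hf⟩ := h.exists_fin
  exact ⟨d, _, hf⟩

theorem isChannelWithKraus_sqrt_smul_mat {n : ℕ} {ι : Type} [Fintype ι] {w : ι → ℝ}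
    (hw : ∀ a, 0 ≤ w a) (hw1 : ∑ a, w a = 1) (g : ι → PauliGroup n) :
    IsChannelWithKraus (∑ a, (w a : ℂ) • conjBy (mat (g a)))
      fun a => (√(w a) : ℂ) • mat (g a) := by
  have h (a : ι) : ‖(√(w a) : ℂ)‖ ^ 2 = w a := by
    rw [Complex.norm_real, Real.norm_eq_abs, sq_abs, Real.sq_sqrt (hw a)]
  constructor
  · simp only [conjBy_smul, h]
  · simp only [conjTranspose_smul_mat_mul_smul_mat, h, ← Finset.sum_smul]
    rw [← Complex.ofReal_sum, hw1, Complex.ofReal_one, one_smul]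

/-- A measurement followed by channels which depend on the outcome is a channel. -/
theorem isChannel_sum_comp_conjBy {n : ℕ} {ι : Type} [Fintype ι] {Φ : ι → SuperOp n}
    {K : ι → Op n} (hΦ : ∀ a, IsChannel (Φ a)) (hK : ∑ a, (K a)ᴴ * K a = 1) :
    IsChannel (∑ a, Φ a ∘ₗ conjBy (K a)) := by
  choose d L hL using hΦ
  refine IsChannelWithKraus.isChannel (ι := Σ a, Fin (d a)) (K := fun x => L x.1 x.2 * K x.1)
    ⟨?_, ?_⟩
  · rw [Fintype.sum_sigma]
    refine Finset.sum_congr rfl fun a _ => ?_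
    simp only [conjBy_mul]
    rw [(hL a).1]
    ext1 σ
    simp only [LinearMap.sum_apply, LinearMap.comp_apply]
  · rw [Fintype.sum_sigma, ← hK]
    refine Finset.sum_congr rfl fun a _ => ?_
    calc ∑ b, (L a b * K a)ᴴ * (L a b * K a)
        = (K a)ᴴ * (∑ b, (L a b)ᴴ * L a b) * K a := by
          simp only [Matrix.conjTranspose_mul, Finset.mul_sum, Finset.sum_mul, Matrix.mul_assoc]
      _ = _ := by rw [(hL a).2, Matrix.mul_one]

theorem IsChannelWithKraus.trace_apply {n : ℕ} {Φ : SuperOp n} {ι : Type} [Fintype ι]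
    {K : ι → Op n} (h : IsChannelWithKraus Φ K) (σ : Op n) : (Φ σ).trace = σ.trace := by
  rw [h.1, LinearMap.sum_apply, Matrix.trace_sum]
  simp only [conjBy_apply]
  calc ∑ a, (K a * σ * (K a)ᴴ).trace = ((∑ a, (K a)ᴴ * K a) * σ).trace := by
        rw [Finset.sum_mul, Matrix.trace_sum]
        exact Finset.sum_congr rfl fun a _ => by
          rw [Matrix.trace_mul_comm, Matrix.mul_assoc]
    _ = σ.trace := by rw [h.2, Matrix.one_mul]

theorem IsChannelWithKraus.posSemidef_apply {n : ℕ} {Φ : SuperOp n} {ι : Type} [Fintype ι]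
    {K : ι → Op n} (h : IsChannelWithKraus Φ K) {σ : Op n} (hσ : σ.PosSemidef) :
    (Φ σ).PosSemidef := by
  rw [h.1, LinearMap.sum_apply]
  exact Matrix.posSemidef_sum _ fun a _ => hσ.mul_mul_conjTranspose_same (K a)

/-! ## Operators on the code space -/

/-- Four times an operator is a combination of positive semidefinite ones. -/
theorem exists_four_smul_eq {n : ℕ} (X : Op n) : ∃ A B C D : Op n,
    (4 : ℂ) • X = Aᴴ * A - Bᴴ * B + Complex.I • (Cᴴ * C) - Complex.I • (Dᴴ * D) := by
  -- Polarisation of (Y, Z) ↦ Y†Z at the pair (1, X).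
  refine ⟨X + 1, X - 1, X + Complex.I • 1, X - Complex.I • 1, ?_⟩
  simp only [Matrix.conjTranspose_add, Matrix.conjTranspose_sub, Matrix.conjTranspose_smul,
    Matrix.conjTranspose_one, Complex.star_def, Complex.conj_I, Matrix.add_mul, Matrix.mul_add,
    Matrix.sub_mul, Matrix.mul_sub, Matrix.smul_mul, Matrix.mul_smul, Matrix.one_mul,
    Matrix.mul_one, smul_add, smul_sub, smul_smul, neg_smul, smul_neg, neg_mul,
    Complex.I_mul_I]
  module

/-- Superoperators which agree on the code states agree on all operators on the code space. -/
theorem apply_eq_of_isCodeState {n : ℕ} {S : Subgroup (PauliGroup n)} {Φ Ψ : SuperOp n}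
    (h : ∀ ρ, IsCodeState S ρ → Φ ρ = Ψ ρ) (X : Op n) :
    Φ (codeProjector S * X * codeProjector S) = Ψ (codeProjector S * X * codeProjector S) := by
  have key (Y : Op n) : Φ (codeProjector S * (Yᴴ * Y) * codeProjector S) =
      Ψ (codeProjector S * (Yᴴ * Y) * codeProjector S) := by
    set Z := codeProjector S * (Yᴴ * Y) * codeProjector S with hZ
    have hpos : Z.PosSemidef := by
      have := (Matrix.posSemidef_conjTranspose_mul_self Y).mul_mul_conjTranspose_same
        (codeProjector S)
      rwa [codeProjector_isHermitian] at this
    have hsupp : codeProjector S * Z * codeProjector S = Z := by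
      rw [hZ]
      simp only [Matrix.mul_assoc, codeProjector_mul_self]
      simp only [← Matrix.mul_assoc, codeProjector_mul_self]
    -- A positive operator of trace zero vanishes; any other one is a multiple of a code state.
    by_cases ht : Z.trace = 0
    · rw [hpos.trace_eq_zero_iff.mp ht, map_zero, map_zero]
    · have hρ : IsCodeState S (Z.trace⁻¹ • Z) := by
        refine ⟨hpos.smul ?_, ?_, ?_⟩
        · exact inv_nonneg.mpr hpos.trace_nonneg
        · rw [Matrix.trace_smul, smul_eq_mul, inv_mul_cancel₀ ht]
        · rw [Matrix.mul_smul, Matrix.smul_mul, hsupp]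
      have := h _ hρ
      rw [map_smul, map_smul] at this
      exact smul_right_injective _ (inv_ne_zero ht) this
  have h4 : (4 : ℂ) • (codeProjector S * X * codeProjector S) =
      codeProjector S * ((4 : ℂ) • X) * codeProjector S := by
    rw [Matrix.mul_smul, Matrix.smul_mul]
  refine smul_right_injective _ (four_ne_zero (α := ℂ)) ?_
  beta_reduce
  simp only [← map_smul]
  obtain ⟨A, B, C, D, hX⟩ := exists_four_smul_eq X
  rw [h4, hX]
  simp only [Matrix.mul_add, Matrix.mul_sub, Matrix.add_mul, Matrix.sub_mul, Matrix.mul_smul,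
    Matrix.smul_mul, map_add, map_sub, map_smul, key]

/-- The left side is the trace of the superoperator X ↦ B X C. With C = B† it becomes |tr B|², which
detects Pauli components of a mixture. -/
theorem sum_mul_single_mul_apply {n : ℕ} (B C : Op n) :
    ∑ i, ∑ j, (B * Matrix.single i j 1 * C : Op n) i j = B.trace * C.trace := by
  rw [Matrix.trace, Matrix.trace, Finset.sum_mul_sum]
  refine Finset.sum_congr rfl fun i _ => Finset.sum_congr rfl fun j _ => ?_
  simp [Matrix.mul_apply, Matrix.single_apply, ite_and]

/-- If two mixtures of Pauli operators agree on the code space, then each Pauli operator in the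
first one occurs in the second one, up to a phase and the stabiliser. -/
theorem exists_phaseEq_of_sum_eq {n : ℕ} {S : Subgroup (PauliGroup n)}
    (hS : ∀ s ∈ S, mat s ≠ -1) {ι κ : Type} [Fintype ι] [Fintype κ] {w : ι → ℝ} {v : κ → ℝ}
    {g : ι → PauliGroup n} {h : κ → PauliGroup n} (hw : ∀ a, 0 ≤ w a)
    (H : ∀ X, ∑ a, (w a : ℂ) • conjBy (mat (g a)) (codeProjector S * X * codeProjector S) =
      ∑ b, (v b : ℂ) • conjBy (mat (h b)) (codeProjector S * X * codeProjector S))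
    {a₀ : ι} (ha₀ : w a₀ ≠ 0) : ∃ b, PhaseEq S (h b) (g a₀) := by
  by_contra! hb
  set B := mat (g a₀) * codeProjector S with hB
  -- Following a mixture by X ↦ B†XB and taking the superoperator trace gives its weights times
  -- squared overlaps with g a₀ on the code.
  have key {μ : Type} [Fintype μ] (u : μ → ℝ) (f : μ → PauliGroup n) :
      ∑ i, ∑ j, (Bᴴ * (∑ a, (u a : ℂ) • conjBy (mat (f a)) (codeProjector S *
        Matrix.single i j 1 * codeProjector S)) * B : Op n) i j =
      ∑ a, (u a : ℂ) * ((‖((mat (g a₀))ᴴ * mat (f a) * codeProjector S).trace‖ ^ 2 : ℝ) : ℂ) := by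
    have h1 (i j : Idx n) (a : μ) : Bᴴ * conjBy (mat (f a)) (codeProjector S *
        Matrix.single i j 1 * codeProjector S) * B =
        (Bᴴ * (mat (f a) * codeProjector S)) * Matrix.single i j 1 *
          (Bᴴ * (mat (f a) * codeProjector S))ᴴ := by
      simp only [conjBy_apply, Matrix.conjTranspose_mul, Matrix.conjTranspose_conjTranspose,
        codeProjector_isHermitian, Matrix.mul_assoc]
    have h2 (a : μ) : (Bᴴ * (mat (f a) * codeProjector S)).trace =
        ((mat (g a₀))ᴴ * mat (f a) * codeProjector S).trace := by
      rw [hB, Matrix.conjTranspose_mul, codeProjector_isHermitian, Matrix.mul_assoc,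
        Matrix.trace_mul_comm]
      simp only [Matrix.mul_assoc, codeProjector_mul_self]
    simp only [Finset.mul_sum, Finset.sum_mul, Matrix.mul_smul, Matrix.smul_mul, h1,
      Matrix.sum_apply, Matrix.smul_apply]
    rw [Finset.sum_congr rfl fun i _ => Finset.sum_comm, Finset.sum_comm]
    refine Finset.sum_congr rfl fun a _ => ?_
    simp only [← Finset.smul_sum]
    rw [sum_mul_single_mul_apply, Matrix.trace_conjTranspose, h2, smul_eq_mul, Complex.star_def,
      Complex.mul_conj, Complex.normSq_eq_norm_sq]
  -- If no h b were equivalent to g a₀, the second mixture would have trace 0, whereas the first is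
  -- a sum of nonnegative terms that includes w a₀ · |tr P|² ≠ 0.
  have h1 := key w g
  simp only [H] at h1
  rw [key v h, Finset.sum_eq_zero] at h1
  · have h2 : ∑ a, w a * ‖((mat (g a₀))ᴴ * mat (g a) * codeProjector S).trace‖ ^ 2 = 0 := by
      exact_mod_cast h1.symm
    rw [Finset.sum_eq_zero_iff_of_nonneg fun a _ => mul_nonneg (hw a) (sq_nonneg _)] at h2
    have h3 := h2 a₀ (Finset.mem_univ _)
    rw [conjTranspose_mat_mul_mat, Matrix.one_mul] at h3
    simp [ha₀, trace_codeProjector_ne_zero hS] at h3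
  · intro b _
    rw [(phaseEq_or_trace_eq_zero S (h b) (g a₀)).resolve_left (hb b)]
    simp

/-! ## Pauli channels -/

theorem IsChannelWithKraus.eq_sum_smul_mat {n : ℕ} {Φ : SuperOp n} {ι : Type} [Fintype ι]
    {K : ι → Op n} (h : IsChannelWithKraus Φ K) {c : ι → ℂ} {g : ι → PauliGroup n}
    (hK : ∀ a, K a = c a • mat (g a)) :
    Φ = ∑ a, ((‖c a‖ ^ 2 : ℝ) : ℂ) • conjBy (mat (g a)) ∧ ∑ a, ‖c a‖ ^ 2 = 1 := by
  obtain rfl : K = fun a => c a • mat (g a) := funext hK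
  refine ⟨?_, sum_norm_sq_eq_one h.2⟩
  rw [h.1]
  simp only [conjBy_smul]

theorem IsPhysicalNoise.eq_sum {n : ℕ} {E : Set (PauliGroup n)} {Φ : SuperOp n}
    (h : IsPhysicalNoise E Φ) : ∃ (d : ℕ) (w : Fin d → ℝ) (e : Fin d → PauliGroup n),
      (∀ a, 0 ≤ w a) ∧ ∑ a, w a = 1 ∧ (∀ a, e a ∈ E) ∧
        Φ = ∑ a, (w a : ℂ) • conjBy (mat (e a)) := by
  obtain ⟨d, K, hΦ, hK⟩ := h
  choose e he c hc using hK
  obtain ⟨h1, h2⟩ := hΦ.eq_sum_smul_mat hc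
  exact ⟨d, fun a => ‖c a‖ ^ 2, e, fun a => sq_nonneg _, h2, he, h1⟩

theorem isPhysicalNoise_conjBy {n : ℕ} {E : Set (PauliGroup n)} {e : PauliGroup n} (he : e ∈ E) :
    IsPhysicalNoise E (conjBy (mat e)) :=
  ⟨1, fun _ => mat e, ⟨by simp, by simp [conjTranspose_mat_mul_mat]⟩,
    fun _ => ⟨e, he, 1, (one_smul _ _).symm⟩⟩

/-- This keeps operators in the form P X P, so that identities valid for all X can be applied again
after a logical operator. -/
theorem conjBy_normalizer_apply {n : ℕ} {S : Subgroup (PauliGroup n)} (g : Normalizer S)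
    (X : Op n) : conjBy (mat (g : PauliGroup n)) (codeProjector S * X * codeProjector S) =
      codeProjector S * conjBy (mat (g : PauliGroup n)) X * codeProjector S := by
  have h1 := normalizer_mat_mul_codeProjector S g
  have h2 := congrArg Matrix.conjTranspose h1
  rw [Matrix.conjTranspose_mul, Matrix.conjTranspose_mul, codeProjector_isHermitian] at h2
  simp only [conjBy_apply, ← Matrix.mul_assoc, h1]
  simp only [Matrix.mul_assoc, h2]

theorem isCodeState_sum {n : ℕ} {S : Subgroup (PauliGroup n)} {ι : Type} [Fintype ι]
    {w : ι → ℝ} (hw : ∀ a, 0 ≤ w a) (hw1 : ∑ a, w a = 1) (g : ι → Normalizer S) {ρ : Op n}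
    (hρ : IsCodeState S ρ) :
    IsCodeState S ((∑ a, (w a : ℂ) • conjBy (mat (g a : PauliGroup n))) ρ) := by
  have hK := isChannelWithKraus_sqrt_smul_mat hw hw1 fun a => (g a : PauliGroup n)
  refine ⟨hK.posSemidef_apply hρ.posSemidef, (hK.trace_apply ρ).trans hρ.trace, ?_⟩
  simp only [LinearMap.sum_apply, LinearMap.smul_apply, Finset.mul_sum, Finset.sum_mul,
    Matrix.mul_smul, Matrix.smul_mul]
  refine Finset.sum_congr rfl fun a _ => congrArg _ ?_
  rw [← conjBy_normalizer_apply, hρ.support]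

theorem isALNC_sum {n k : ℕ} {S : Subgroup (PauliGroup n)} {M : Set (PauliGroup k)}
    {A : LogicalIso S k} {ι : Type} [Fintype ι]
    {w : ι → ℝ} (hw : ∀ a, 0 ≤ w a) (hw1 : ∑ a, w a = 1) (g : ι → Normalizer S)
    (hg : ∀ a, (g a : LogicalGroup S) ∈ A '' M) :
    IsALNC S M A (∑ a, (w a : ℂ) • conjBy (mat (g a : PauliGroup n))) := by
  refine ⟨?_, fun ρ hρ => isCodeState_sum hw hw1 g hρ⟩
  obtain ⟨d, f, hf⟩ :=
    (isChannelWithKraus_sqrt_smul_mat hw hw1 fun a => (g a : PauliGroup n)).exists_fin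
  refine ⟨d, _, hf, fun a => ?_⟩
  obtain ⟨m, hm, hmg⟩ := hg (f a)
  exact ⟨m, hm, g (f a), hmg.symm, _, rfl⟩

/-- On an error in `E`, a transmuting operation is a mixture of admissible logical operators. -/
theorem IsTransmuting.exists_sum {n k : ℕ} {S : Subgroup (PauliGroup n)} {E : Set (PauliGroup n)}
    {M : Set (PauliGroup k)} {A : LogicalIso S k} {R : SuperOp n} (hR : IsTransmuting S E M A R)
    {e : PauliGroup n} (he : e ∈ E) :
    ∃ (d : ℕ) (w : Fin d → ℝ) (g : Fin d → Normalizer S), (∀ a, 0 ≤ w a) ∧ ∑ a, w a = 1 ∧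
      (∀ a, (g a : LogicalGroup S) ∈ A '' M) ∧
      ∀ X, R (conjBy (mat e) (codeProjector S * X * codeProjector S)) =
        ∑ a, (w a : ℂ) • conjBy (mat (g a : PauliGroup n))
          (codeProjector S * X * codeProjector S) := by
  -- The channel that applies e with certainty is itself physical noise.
  obtain ⟨Λ, ⟨⟨d, K, hΛ, hK⟩, -⟩, hRΛ⟩ := hR.2 _ (isPhysicalNoise_conjBy he)
  choose m hm g hg c hc using hK
  obtain ⟨h1, h2⟩ := hΛ.eq_sum_smul_mat hc
  refine ⟨d, fun a => ‖c a‖ ^ 2, g, fun a => sq_nonneg _, h2,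
    fun a => ⟨m a, hm a, (hg a).symm⟩, fun X => ?_⟩
  have h3 := apply_eq_of_isCodeState (Φ := R ∘ₗ conjBy (mat e)) (Ψ := Λ) hRΛ X
  rw [LinearMap.comp_apply] at h3
  rw [h3, h1, LinearMap.sum_apply]
  rfl

/-! ## Maps which preserve bilinears -/

section maps

variable {n k : ℕ} {S : Subgroup (PauliGroup n)} {E : Set (PauliGroup n)}
  {M : Set (PauliGroup k)} {A : LogicalIso S k} {𝔫 : Syndrome S}

theorem preservesBilinearsRep_iff_phaseEq (π : ErrorMap S E M A 𝔫) :
    PreservesBilinearsRep π ↔ ∀ (e f : errorsIn S E 𝔫) (a b : Normalizer S),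
      (a : LogicalGroup S) = π e → (b : LogicalGroup S) = π f →
      PhaseEq S ((e : PauliGroup n)⁻¹ * f) ((a : PauliGroup n)⁻¹ * b) :=
  Iff.rfl

theorem logicalAction_coe_apply (a : Normalizer S) (v : codeSpace S) :
    ((logicalAction S (a : LogicalGroup S) v : codeSpace S) : Idx n → ℂ) =
      mat (a : PauliGroup n) *ᵥ (v : Idx n → ℂ) := rfl

theorem mul_codeProjector_eq_iff (B C : Op n) :
    B * codeProjector S = C * codeProjector S ↔
      ∀ v : codeSpace S, B *ᵥ (v : Idx n → ℂ) = C *ᵥ (v : Idx n → ℂ) := by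
  constructor
  · intro h v
    rw [← (codeProjector_mulVec_eq_iff S v.1).mpr v.2, Matrix.mulVec_mulVec, h,
      ← Matrix.mulVec_mulVec]
  · intro h
    refine Matrix.toLin'.injective (LinearMap.ext fun v => ?_)
    have hv : codeProjector S *ᵥ v ∈ codeSpace S := by
      rw [← codeProjector_mulVec_eq_iff, Matrix.mulVec_mulVec, codeProjector_mul_self]
    rw [Matrix.toLin'_apply, Matrix.toLin'_apply, ← Matrix.mulVec_mulVec, ← Matrix.mulVec_mulVec]
    exact h ⟨_, hv⟩

/-- N(S)/S acts through any representative, and two operators agree on the code exactly when their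
products with P agree. -/
theorem preservesBilinears_iff_rep (π : ErrorMap S E M A 𝔫) :
    PreservesBilinears π ↔ PreservesBilinearsRep π := by
  have key (e f : PauliGroup n) (a b : Normalizer S) (c : ℂ) :
      (∀ v : codeSpace S, ((mat e)ᴴ * mat f) *ᵥ (v : Idx n → ℂ) =
        c • ((logicalAction S ((a : LogicalGroup S)⁻¹ * (b : LogicalGroup S)) v :
          codeSpace S) : Idx n → ℂ)) ↔
      (mat e)ᴴ * mat f * codeProjector S =
        c • ((mat (a : PauliGroup n))ᴴ * mat (b : PauliGroup n) * codeProjector S) := by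
    have h1 (v : codeSpace S) : c • ((logicalAction S ((a : LogicalGroup S)⁻¹ *
        (b : LogicalGroup S)) v : codeSpace S) : Idx n → ℂ) =
        (c • ((mat (a : PauliGroup n))ᴴ * mat (b : PauliGroup n))) *ᵥ (v : Idx n → ℂ) := by
      rw [Matrix.smul_mulVec]
      exact congrArg _ (logicalAction_coe_apply (a⁻¹ * b) v)
    rw [← Matrix.smul_mul, mul_codeProjector_eq_iff]
    simp only [h1]
  constructor
  · intro h e f a b ha hb
    obtain ⟨c, hc, H⟩ := h e f
    rw [← ha, ← hb] at H
    exact ⟨c, hc, (key _ _ _ _ _).mp H⟩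
  · intro h e f
    obtain ⟨a, ha⟩ := QuotientGroup.mk_surjective (π e : LogicalGroup S)
    obtain ⟨b, hb⟩ := QuotientGroup.mk_surjective (π f : LogicalGroup S)
    obtain ⟨c, hc, H⟩ := h e f a b ha hb
    refine ⟨c, hc, ?_⟩
    rw [← ha, ← hb]
    exact (key _ _ _ _ _).mpr H

theorem errorsIn_inv_mul_mem (e f : errorsIn S E 𝔫) :
    (e : PauliGroup n)⁻¹ * f ∈ Normalizer S :=
  QuotientGroup.eq.mp (e.2.2.trans f.2.2.symm)

/-- In (g e₀⁻¹ e)⁻¹ (g e₀⁻¹ f) the common factor g e₀⁻¹ cancels and leaves e⁻¹ f. -/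
theorem preservesBilinears_of_phaseEq {π : ErrorMap S E M A 𝔫} (e₀ : errorsIn S E 𝔫)
    (g : Normalizer S) (h : ∀ f, ∃ b : Normalizer S, (b : LogicalGroup S) = π f ∧
      PhaseEq S b (g * ((e₀ : PauliGroup n)⁻¹ * f))) : PreservesBilinears π := by
  rw [preservesBilinears_iff_rep, preservesBilinearsRep_iff_phaseEq]
  have h' (f : errorsIn S E 𝔫) (b : Normalizer S) (hb : (b : LogicalGroup S) = π f) :
      PhaseEq S b (g * ((e₀ : PauliGroup n)⁻¹ * f)) := by
    obtain ⟨b', hb', H⟩ := h f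
    exact (PhaseEq.of_coe_eq (hb.trans hb'.symm)).trans H
  intro e f a b ha hb
  have hmem (f : errorsIn S E 𝔫) : (g : PauliGroup n) * ((e₀ : PauliGroup n)⁻¹ * f) ∈
      Normalizer S := mul_mem g.2 (errorsIn_inv_mul_mem e₀ f)
  have h1 := ((h' e a ha).inv (hmem e)).mul_right (hmem f)
  have h2 : ((g : PauliGroup n) * ((e₀ : PauliGroup n)⁻¹ * e))⁻¹ *
      (g * ((e₀ : PauliGroup n)⁻¹ * f)) = (e : PauliGroup n)⁻¹ * f := by group
  rw [h2] at h1
  exact (((h' f b hb).mul_left _).trans h1).symm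

/-- The bilinear condition multiplied by a on the left: the correction a e⁻¹ chosen for e also
handles f. -/
theorem PreservesBilinears.phaseEq {π : ErrorMap S E M A 𝔫} (hπ : PreservesBilinears π)
    (e f : errorsIn S E 𝔫) {a b : Normalizer S} (ha : (a : LogicalGroup S) = π e)
    (hb : (b : LogicalGroup S) = π f) :
    PhaseEq S (a * (e : PauliGroup n)⁻¹ * f) b := by
  have h := ((preservesBilinearsRep_iff_phaseEq π).mp ((preservesBilinears_iff_rep π).mp hπ)
    e f a b ha hb).mul_left a
  rwa [mul_inv_cancel_left, ← mul_assoc] at h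

/-- Each logical operator in the recovery from one error extends to a map on all errors with the
same syndrome. -/
theorem IsTransmuting.exists_transmutingMap {R : SuperOp n} (hS : ∀ s ∈ S, mat s ≠ -1)
    (hR : IsTransmuting S E M A R) (e : errorsIn S E 𝔫) {d : ℕ} {w : Fin d → ℝ}
    {g : Fin d → Normalizer S} (hw : ∀ a, 0 ≤ w a)
    (hg : ∀ X, R (conjBy (mat (e : PauliGroup n)) (codeProjector S * X * codeProjector S)) =
        ∑ a, (w a : ℂ) • conjBy (mat (g a : PauliGroup n))
          (codeProjector S * X * codeProjector S)) {a₀ : Fin d} (ha₀ : w a₀ ≠ 0) :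
    ∃ π : TransmutingMap S E M A 𝔫, ∀ f, ∃ b : Normalizer S, (b : LogicalGroup S) = π.1 f ∧
      PhaseEq S b (g a₀ * ((e : PauliGroup n)⁻¹ * f)) := by
  have key (f : errorsIn S E 𝔫) : ∃ b : Normalizer S, (b : LogicalGroup S) ∈ A '' M ∧
      PhaseEq S b (g a₀ * ((e : PauliGroup n)⁻¹ * f)) := by
    obtain ⟨d', v, h, -, -, hh, hv⟩ := hR.exists_sum f.2.1
    obtain ⟨x, hx⟩ : ∃ x : Normalizer S, (x : PauliGroup n) = (e : PauliGroup n)⁻¹ * f :=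
      ⟨⟨_, errorsIn_inv_mul_mem e f⟩, rfl⟩
    have hf : (f : PauliGroup n) = e * x := by rw [hx, mul_inv_cancel_left]
    rw [← hx]
    -- Since f = e x with x ∈ N(S), the output on f is both the mixture of the g a * x and a mixture
    -- of admissible operators h b.
    obtain ⟨b, hb⟩ := exists_phaseEq_of_sum_eq (v := v) hS
      (g := fun a => (g a * x : PauliGroup n)) (h := fun b => (h b : PauliGroup n)) hw
      (fun X => by
        rw [← hv, hf, mat_mul, conjBy_mul, LinearMap.comp_apply, conjBy_normalizer_apply, hg]
        simp only [mat_mul, conjBy_mul, LinearMap.comp_apply, conjBy_normalizer_apply]) ha₀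
    exact ⟨h b, hh b, hb⟩
  choose b hb hb' using key
  refine ⟨⟨fun f => ⟨b f, hb f⟩, preservesBilinears_of_phaseEq e (g a₀) fun f => ⟨b f, rfl, hb' f⟩⟩,
    fun f => ⟨b f, rfl, hb' f⟩⟩

end maps

/-! ## The recovery protocol -/

section protocol

variable {n k : ℕ} {S : Subgroup (PauliGroup n)} {E : Set (PauliGroup n)}
  {M : Set (PauliGroup k)} {A : LogicalIso S k}
  {ref : ∀ 𝔫 : Syndrome S, (errorsIn S E 𝔫).Nonempty → errorsIn S E 𝔫}
  {rep : LogicalGroup S → Normalizer S}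
  {r : ∀ 𝔫 : Syndrome S, TransmutingMap S E M A 𝔫 → ℝ} {Q : Syndrome S → SuperOp n}

theorem conjBy_syndromeProjector_conjBy_mat (e : PauliGroup n) (X : Op n) :
    conjBy (syndromeProjector S (e : Syndrome S))
      (conjBy (mat e) (codeProjector S * X * codeProjector S)) =
      conjBy (mat e) (codeProjector S * X * codeProjector S) := by
  have h1 : syndromeProjector S (e : Syndrome S) * mat e * codeProjector S =
      mat e * codeProjector S := by
    rw [syndromeProjector_mul_mat, Matrix.mul_assoc, codeProjector_mul_self]
  have h2 := congrArg Matrix.conjTranspose h1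
  simp only [Matrix.conjTranspose_mul, codeProjector_isHermitian, syndromeProjector_isHermitian]
    at h2
  simp only [conjBy_apply, ← Matrix.mul_assoc, h1, syndromeProjector_isHermitian]
  simp only [Matrix.mul_assoc, h2]

theorem conjBy_syndromeProjector_conjBy_mat_of_ne {e : PauliGroup n} {𝔫 : Syndrome S}
    (h : (e : Syndrome S) ≠ 𝔫) (X : Op n) :
    conjBy (syndromeProjector S 𝔫)
      (conjBy (mat e) (codeProjector S * X * codeProjector S)) = 0 := by
  simp only [conjBy_apply, ← Matrix.mul_assoc, syndromeProjector_mul_mat_mul_codeProjector S h,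
    Matrix.zero_mul]

/-- A Pauli error maps the code into a single syndrome subspace, so the measurement does not disturb
the state. -/
theorem syndromeMeasurement_conjBy_mat (e : PauliGroup n) (X : Op n) :
    syndromeMeasurement S (conjBy (mat e) (codeProjector S * X * codeProjector S)) =
      conjBy (mat e) (codeProjector S * X * codeProjector S) := by
  rw [syndromeMeasurement, LinearMap.sum_apply, Finset.sum_eq_single (e : Syndrome S),
    conjBy_syndromeProjector_conjBy_mat]
  · exact fun 𝔫 _ h => conjBy_syndromeProjector_conjBy_mat_of_ne h.symm X
  · simp

/-- A state with syndrome `𝔫` is the image of an operator on the code space. -/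
theorem conjBy_syndromeProjector_apply {e : PauliGroup n} {𝔫 : Syndrome S}
    (h : (e : Syndrome S) = 𝔫) (σ : Op n) :
    conjBy (syndromeProjector S 𝔫) σ =
      conjBy (mat e) (codeProjector S * conjBy (mat e)ᴴ σ * codeProjector S) := by
  subst h
  rw [syndromeProjector_mk]
  simp only [conjBy_apply, Matrix.conjTranspose_mul, Matrix.conjTranspose_conjTranspose,
    codeProjector_isHermitian, Matrix.mul_assoc]

/-- The recovery applied on an outcome turns each error with this syndrome into a mixture of the
logical operators assigned to it. -/
theorem sum_conjBy_recovery {𝔫 : Syndrome S}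
    (hrep : ∀ q : LogicalGroup S, (rep q : LogicalGroup S) = q)
    (r : TransmutingMap S E M A 𝔫 → ℝ) (e f : errorsIn S E 𝔫) (X : Op n) :
    (∑ π : TransmutingMap S E M A 𝔫, (r π : ℂ) •
        conjBy (mat (rep (π.1 e) : PauliGroup n) * (mat (e : PauliGroup n))ᴴ))
      (conjBy (mat (f : PauliGroup n)) (codeProjector S * X * codeProjector S)) =
    ∑ π : TransmutingMap S E M A 𝔫, (r π : ℂ) • conjBy (mat (rep (π.1 f) : PauliGroup n))
      (codeProjector S * X * codeProjector S) := by
  rw [LinearMap.sum_apply]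
  refine Finset.sum_congr rfl fun π _ => ?_
  rw [LinearMap.smul_apply, ← LinearMap.comp_apply, ← conjBy_mul, ← mat_inv, ← mat_mul, ← mat_mul,
    (π.2.phaseEq e f (hrep _) (hrep _)).conjBy_eq]

theorem protocol_conjBy_mat (hrep : ∀ q : LogicalGroup S, (rep q : LogicalGroup S) = q)
    {𝔫 : Syndrome S} (f : errorsIn S E 𝔫) (X : Op n) :
    protocol ref rep r Q
        (conjBy (mat (f : PauliGroup n)) (codeProjector S * X * codeProjector S)) =
      ∑ π : TransmutingMap S E M A 𝔫, (r 𝔫 π : ℂ) • conjBy (mat (rep (π.1 f) : PauliGroup n))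
        (codeProjector S * X * codeProjector S) := by
  obtain ⟨f, hf, rfl⟩ := f
  rw [protocol, LinearMap.sum_apply, Finset.sum_eq_single (f : Syndrome S)]
  · rw [LinearMap.comp_apply, conjBy_syndromeProjector_conjBy_mat]
    split_ifs with h
    · exact sum_conjBy_recovery hrep _ _ ⟨f, hf, rfl⟩ X
    · exact absurd ⟨f, hf, rfl⟩ h
  · intro 𝔫 _ h
    rw [LinearMap.comp_apply, conjBy_syndromeProjector_conjBy_mat_of_ne h.symm, map_zero]
  · simp

theorem sum_conjTranspose_syndromeProjector_mul_self (hS : ∀ s ∈ S, mat s ≠ -1) :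
    ∑ 𝔫, (syndromeProjector S 𝔫)ᴴ * syndromeProjector S 𝔫 = 1 := by
  simp only [syndromeProjector_isHermitian, syndromeProjector_mul_self, sum_syndromeProjector hS]

theorem isChannel_protocol (hS : ∀ s ∈ S, mat s ≠ -1) (hr : IsDistribution r)
    (hQ : ∀ 𝔫, IsChannel (Q 𝔫)) : IsChannel (protocol ref rep r Q) := by
  refine isChannel_sum_comp_conjBy (fun 𝔫 => ?_) (sum_conjTranspose_syndromeProjector_mul_self hS)
  split_ifs with h
  · exact (isChannelWithKraus_sqrt_smul_mat (hr 𝔫).1 (hr 𝔫).2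
      fun π => (rep (π.1 (ref 𝔫 h)) : PauliGroup n) * (ref 𝔫 h : PauliGroup n)⁻¹).isChannel
  · exact hQ 𝔫

/-- Noise that applies error e_a with weight w_a becomes the logical mixture in which π(e_a) has
weight w_a · r(π), with r taken at the syndrome of e_a. -/
theorem isTransmuting_protocol (hS : ∀ s ∈ S, mat s ≠ -1)
    (hrep : ∀ q : LogicalGroup S, (rep q : LogicalGroup S) = q) (hr : IsDistribution r)
    (hQ : ∀ 𝔫, IsChannel (Q 𝔫)) : IsTransmuting S E M A (protocol ref rep r Q) := by
  refine ⟨isChannel_protocol hS hr hQ, fun Φ hΦ => ?_⟩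
  obtain ⟨d, w, e, hw, hw1, he, rfl⟩ := hΦ.eq_sum
  let e' (a : Fin d) : errorsIn S E (e a : Syndrome S) := ⟨e a, he a, rfl⟩
  refine ⟨∑ x : Σ a, TransmutingMap S E M A (e a : Syndrome S),
    ((w x.1 * r _ x.2 : ℝ) : ℂ) • conjBy (mat (rep (x.2.1 (e' x.1)) : PauliGroup n)),
    isALNC_sum (fun x => mul_nonneg (hw _) ((hr _).1 _)) ?_ _ fun x => ?_, fun ρ hρ => ?_⟩
  · rw [Fintype.sum_sigma]
    simp only [← Finset.mul_sum, (hr _).2, mul_one, hw1]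
  · rw [hrep]
    exact (x.2.1 _).2
  · rw [← hρ.support, LinearMap.sum_apply, map_sum, LinearMap.sum_apply, Fintype.sum_sigma]
    refine Finset.sum_congr rfl fun a _ => ?_
    rw [LinearMap.smul_apply, map_smul]
    refine (congrArg _ (protocol_conjBy_mat hrep (e' a) ρ)).trans ?_
    rw [Finset.smul_sum]
    refine Finset.sum_congr rfl fun π _ => ?_
    rw [LinearMap.smul_apply, smul_smul, Complex.ofReal_mul]

/-- On each outcome, a transmuting operation is a random choice of maps which preserve
bilinears. -/
theorem IsTransmuting.exists_distribution {R : SuperOp n} (hS : ∀ s ∈ S, mat s ≠ -1)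
    (hrep : ∀ q : LogicalGroup S, (rep q : LogicalGroup S) = q)
    (hR : IsTransmuting S E M A R) {𝔫 : Syndrome S} (e : errorsIn S E 𝔫) :
    ∃ r : TransmutingMap S E M A 𝔫 → ℝ, (∀ π, 0 ≤ r π) ∧ ∑ π, r π = 1 ∧
      R ∘ₗ conjBy (syndromeProjector S 𝔫) = (∑ π : TransmutingMap S E M A 𝔫, (r π : ℂ) •
        conjBy (mat (rep (π.1 e) : PauliGroup n) * (mat (e : PauliGroup n))ᴴ)) ∘ₗ
          conjBy (syndromeProjector S 𝔫) := by
  classical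
  obtain ⟨d, w, g, hw, hw1, hgM, hg⟩ := hR.exists_sum e.2.1
  have key (a : Fin d) (ha : w a ≠ 0) := hR.exists_transmutingMap hS e hw hg ha
  obtain ⟨a₀, ha₀⟩ : ∃ a, w a ≠ 0 := by
    by_contra! h
    simp [h] at hw1
  -- Indices of weight zero carry no information; they receive the map of a₀ so that the choice is
  -- total.
  have key' (a : Fin d) : ∃ π : TransmutingMap S E M A 𝔫, w a ≠ 0 → ∃ b : Normalizer S,
      (b : LogicalGroup S) = π.1 e ∧ PhaseEq S b (g a) := by
    by_cases ha : w a = 0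
    · exact ⟨(key a₀ ha₀).choose, fun h => absurd ha h⟩
    · obtain ⟨π, hπ⟩ := key a ha
      refine ⟨π, fun _ => ?_⟩
      simpa using hπ e
  choose π hπ using key'
  -- Several logical operators may yield the same map, so its probability is the total weight of the
  -- fibre.
  refine ⟨fun x => ∑ a with π a = x, w a, fun x => Finset.sum_nonneg fun a _ => hw a, ?_, ?_⟩
  · rw [Finset.sum_fiberwise, hw1]
  · ext1 σ
    -- After projection any σ has the form e (P X P) e†, so the description of R on the single error
    -- e covers it.
    rw [LinearMap.comp_apply, LinearMap.comp_apply, conjBy_syndromeProjector_apply e.2.2, hg,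
      sum_conjBy_recovery hrep]
    rw [← Finset.sum_fiberwise Finset.univ π]
    refine Finset.sum_congr rfl fun x _ => ?_
    rw [Complex.ofReal_sum, Finset.sum_smul]
    refine Finset.sum_congr rfl fun a ha => ?_
    obtain rfl := (Finset.mem_filter.mp ha).2
    by_cases h0 : w a = 0
    · rw [h0, Complex.ofReal_zero, zero_smul, zero_smul]
    · obtain ⟨b, hb, hbg⟩ := hπ a h0
      rw [(hbg.symm.trans (PhaseEq.of_coe_eq (hb.trans (hrep _).symm))).conjBy_eq]

theorem IsTransmuting.exists_protocol {R : SuperOp n} (hS : ∀ s ∈ S, mat s ≠ -1)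
    (hrep : ∀ q : LogicalGroup S, (rep q : LogicalGroup S) = q)
    (hR : IsTransmuting S E M A R) :
    ∃ (r : ∀ 𝔫 : Syndrome S, TransmutingMap S E M A 𝔫 → ℝ) (Q : Syndrome S → SuperOp n),
      IsDistribution r ∧ (∀ 𝔫, IsChannel (Q 𝔫)) ∧
      R ∘ₗ syndromeMeasurement S = protocol ref rep r Q ∧
      ∀ Φ, IsPhysicalNoise E Φ → ∀ ρ, IsCodeState S ρ →
        R (Φ ρ) = protocol ref rep r Q (Φ ρ) := by
  have key (𝔫 : Syndrome S) : ∃ r : TransmutingMap S E M A 𝔫 → ℝ, ((∀ π, 0 ≤ r π) ∧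
      ∑ π, r π = 1) ∧ ∀ h : (errorsIn S E 𝔫).Nonempty,
      R ∘ₗ conjBy (syndromeProjector S 𝔫) = (∑ π : TransmutingMap S E M A 𝔫, (r π : ℂ) •
        conjBy (mat (rep (π.1 (ref 𝔫 h)) : PauliGroup n) *
          (mat (ref 𝔫 h : PauliGroup n))ᴴ)) ∘ₗ conjBy (syndromeProjector S 𝔫) := by
    by_cases h : (errorsIn S E 𝔫).Nonempty
    · obtain ⟨r, hr, hr1, H⟩ := hR.exists_distribution hS hrep (ref 𝔫 h)
      exact ⟨r, ⟨hr, hr1⟩, fun _ => H⟩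
    · have : IsEmpty (errorsIn S E 𝔫) := ⟨fun e => h ⟨e.1, e.2⟩⟩
      -- With no errors there is exactly one map, the empty one, and it carries all the probability.
      have : Unique (TransmutingMap S E M A 𝔫) :=
        { default := ⟨isEmptyElim, isEmptyElim⟩
          uniq := fun π => Subtype.ext (funext isEmptyElim) }
      exact ⟨fun _ => 1, ⟨fun _ => zero_le_one, by rw [Fintype.sum_unique]⟩, fun h' => absurd h' h⟩
  choose r hr H using key
  -- On syndromes without errors R itself serves as the channel Q.
  have hprot : R ∘ₗ syndromeMeasurement S = protocol ref rep r fun _ => R := by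
    ext1 σ
    rw [LinearMap.comp_apply, syndromeMeasurement, protocol, LinearMap.sum_apply, map_sum,
      LinearMap.sum_apply]
    refine Finset.sum_congr rfl fun 𝔫 _ => ?_
    split_ifs with h
    · rw [← H 𝔫 h, LinearMap.comp_apply]
    · rw [LinearMap.comp_apply]
  refine ⟨r, fun _ => R, hr, fun _ => hR.1, hprot, fun Φ hΦ ρ hρ => ?_⟩
  obtain ⟨d, w, e, -, -, -, rfl⟩ := hΦ.eq_sum
  rw [← hprot, LinearMap.comp_apply]
  congr 1
  rw [← hρ.support, LinearMap.sum_apply, map_sum]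
  refine Finset.sum_congr rfl fun a _ => ?_
  rw [LinearMap.smul_apply, map_smul, syndromeMeasurement_conjBy_mat]

end protocol

theorem isChannel_id {n : ℕ} : IsChannel (LinearMap.id : SuperOp n) := by
  refine ⟨1, fun _ => 1, ?_, by simp⟩
  ext1 σ
  simp [conjBy_apply]

/-- A distribution of total mass 1 cannot live on an empty set of maps; conversely, one map per
syndrome gives a protocol with point masses. -/
theorem isQETCode_iff {n k : ℕ} {S : Subgroup (PauliGroup n)} (hS : ∀ s ∈ S, mat s ≠ -1)
    (E : Set (PauliGroup n)) (M : Set (PauliGroup k)) :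
    IsQETCode S E M ↔ ∃ A : LogicalIso S k, ∀ 𝔫 : Syndrome S,
      ∃ π : ErrorMap S E M A 𝔫, PreservesBilinears π := by
  classical
  have hrep (q : LogicalGroup S) : (q.out : LogicalGroup S) = q := QuotientGroup.out_eq' q
  constructor
  · rintro ⟨A, R, hR⟩
    obtain ⟨r, -, hr, -⟩ := hR.exists_protocol hS (ref := fun 𝔫 h => ⟨h.some, h.some_mem⟩) hrep
    refine ⟨A, fun 𝔫 => ?_⟩
    by_contra! h
    have : IsEmpty (TransmutingMap S E M A 𝔫) := ⟨fun π => h π.1 π.2⟩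
    simpa using (hr 𝔫).2
  · rintro ⟨A, hA⟩
    choose π hπ using hA
    refine ⟨A, _, isTransmuting_protocol hS (ref := fun 𝔫 h => ⟨h.some, h.some_mem⟩) hrep
      (r := fun 𝔫 x => if x = ⟨π 𝔫, hπ 𝔫⟩ then 1 else 0) (fun 𝔫 => ⟨fun x => ?_, ?_⟩)
      (Q := fun _ => LinearMap.id) fun _ => isChannel_id⟩
    · beta_reduce
      split_ifs <;> norm_num
    · simp

end QET

open QET
theorem mainTheorem2 (n k : ℕ) (S : Subgroup (PauliGroup n)) (hS : IsStabilizer S k)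
    (E : Set (PauliGroup n)) (M : Set (PauliGroup k)) (hM : 1 ∈ M) :
    (IsQETCode S E M ↔ ∃ A : LogicalIso S k, ∀ 𝔫 : Syndrome S,
      ∃ π : ErrorMap S E M A 𝔫, PreservesBilinears π) ∧
    (IsQETCode S E M ↔ ∃ A : LogicalIso S k, ∀ 𝔫 : Syndrome S,
      ∃ π : ErrorMap S E M A 𝔫, PreservesBilinearsRep π) ∧
    ∀ (A : LogicalIso S k)
      (ref : ∀ 𝔫 : Syndrome S, (errorsIn S E 𝔫).Nonempty → errorsIn S E 𝔫)
      (rep : LogicalGroup S → Normalizer S),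
      (∀ q : LogicalGroup S, (rep q : LogicalGroup S) = q) →
      (∀ (r : ∀ 𝔫 : Syndrome S, TransmutingMap S E M A 𝔫 → ℝ) (Q : Syndrome S → SuperOp n),
        IsDistribution r → (∀ 𝔫, IsChannel (Q 𝔫)) →
          IsTransmuting S E M A (protocol ref rep r Q)) ∧
      (∀ R : SuperOp n, IsTransmuting S E M A R →
        ∃ (r : ∀ 𝔫 : Syndrome S, TransmutingMap S E M A 𝔫 → ℝ) (Q : Syndrome S → SuperOp n),
          IsDistribution r ∧ (∀ 𝔫, IsChannel (Q 𝔫)) ∧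
          R ∘ₗ syndromeMeasurement S = protocol ref rep r Q ∧
          ∀ Φ, IsPhysicalNoise E Φ → ∀ ρ, IsCodeState S ρ →
            R (Φ ρ) = protocol ref rep r Q (Φ ρ)) := by
  refine ⟨isQETCode_iff hS.neg_one E M, ?_, fun A ref rep hrep => ⟨fun r Q hr hQ => ?_,
    fun R hR => hR.exists_protocol hS.neg_one hrep⟩⟩
  · simp only [← preservesBilinears_iff_rep]
    exact isQETCode_iff hS.neg_one E M
  · exact isTransmuting_protocol hS.neg_one hrep hr hQ
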